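/- For finite groups $G$ and $H$ let $B(G,H)$ be the Grothendieck group of isomorphism classes of finite $(G,H)$-bisets with respect to disjoint union. Composition $\circ : B(G,H)\times B(H,K)\to B(G,K)$ is the bilinear map with $[X]\circ[Y]=[X\times_H Y]$, where $X\times_H Y$ is the tensor product of bisets; it makes $B(G,G)$ a ring with identity $\mathrm{Id}_G=[G]$, the double Burnside ring. Let $(-)^\circ : B(G,H)\to B(H,G)$ be the duality induced by taking opposite bisets, and let $$B_\circ(G,G)=\{u\in B(G,G)^\times : uu^\circ=u^\circ u=\mathrm{Id}_G\}$$ be the group of orthogonal units. For a normal subgroup $N$ of $G$ let $\mathrm{Inf}_{G/N}^G\in B(G,G/N)$ and $\mathrm{Def}_{G/N}^G\in B(G/N,G)$ be the classes of the set $G/N$ with its natural actions, and let $$\mathrm{dBInf}_{G/N}^G : B_\circ(G/N,G/N)\to B_\circ(G,G),\qquad u\mapsto \mathrm{Id}_G+\mathrm{Inf}_{G/N}^G\circ(u-\mathrm{Id}_{G/N})\circ\mathrm{Def}_{G/N}^G .$$ For an automorphism $\varphi$ of $G$ put $\Delta_\varphi(G)=\{(\varphi(h),h): h\in G\}\leqslant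 G\times G$. Let $\eta:\mathbb{Z}\mathrm{Out}(G)\to B(G,G)$ be the ring homomorphism sending the class $\overline\varphi$ to $[G\times G/\Delta_\varphi(G)]$; it restricts to a group homomorphism $$\eta:\langle -1,\mathrm{Out}(G)\rangle\to B_\circ(G,G)$$ on the subgroup $\langle -1,\mathrm{Out}(G)\rangle$ of $(\mathbb{Z}\mathrm{Out}(G))^\times$, and $\mathrm{im}(\eta)$ denotes the image of this restriction. Let $\rho: B(G,G)\to\mathbb{Z}\mathrm{Out}(G)$ be the additive map that sends the class of a transitive biset isomorphic to $G\times G/\Delta_\varphi(G)$, with $\varphi$ an automorphism of $G$, to $\overline\varphi$, and the class of every other transitive biset to $0$; let $\rho^\times$ be its restriction to $B_\circ(G,G)$, so that $\ker(\rho^\times)=\{u\in B_\circ(G,G):\rho(u)=1\}$. Let $p$ be an odd prime, $n>1$, and let $G=C_{p^n}$ be cyclic of order $p^n$ with its subgroup $C_p$ of order $p$. Then $B_\circ(G,G)$ is the internal direct product of its subgroups $\mathrm{im}(\eta)$ and $\mathrm{im}(\mathrm{dBInf}_{G/C_p}^{G})$: $$B_\circ(G,G)=\mathrm{im}(\eta)\times\mathrm{im}\bigl(\mathrm{dBInf}_{C_{p^n}/C_p}^{C_{p^n}}\bigr).$$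 Moreover $\ker(\rho^\times)=\mathrm{im}\bigl(\mathrm{dBInf}_{C_{p^n}/C_p}^{C_{p^n}}\bigr)$. -/

import Mathlib

open MulOpposite

universe u

namespace DoubleBurnside

/-! ### Finite bisets -/

/-- A finite `(G, H)`-biset: a finite set with commuting left `G`-action and right `H`-action.
The right action `x · h` is `op h • x`, as usual in Mathlib. -/
structure FinBiset (G H : Type u) [Group G] [Group H] where
  carrier : Type u
  [finite : Finite carrier]
  [left : MulAction G carrier]
  [right : MulAction Hᵐᵒᵖ carrier]
  comm : ∀ (g : G) (h : H) (x : carrier), op h • g • x = g • op h • x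

namespace FinBiset

attribute [instance] FinBiset.finite FinBiset.left FinBiset.right

instance {G H : Type u} [Group G] [Group H] : CoeSort (FinBiset G H) (Type u) := ⟨carrier⟩

variable {G H K L : Type u} [Group G] [Group H] [Group K] [Group L]

instance (X : FinBiset G H) : SMulCommClass G Hᵐᵒᵖ X :=
  ⟨fun g h x => (X.comm g (unop h) x).symm⟩

/-- A map commuting with both actions. -/
def IsBisetMap (X Y : FinBiset G H) (f : X → Y) : Prop :=
  (∀ (g : G) (x : X), f (g • x) = g • f x) ∧ ∀ (h : H) (x : X), f (op h • x) = op h • f x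

/-- Two bisets are isomorphic if there is a bijection between them commuting with both actions. -/
def Isomorphic (X Y : FinBiset G H) : Prop :=
  ∃ e : X ≃ Y, IsBisetMap X Y e

theorem Isomorphic.refl (X : FinBiset G H) : Isomorphic X X :=
  ⟨Equiv.refl _, fun _ _ => rfl, fun _ _ => rfl⟩

theorem Isomorphic.symm {X Y : FinBiset G H} : Isomorphic X Y → Isomorphic Y X := by
  rintro ⟨e, h1, h2⟩
  refine ⟨e.symm, fun g y => ?_, fun h y => ?_⟩
  · rw [Equiv.symm_apply_eq, h1, Equiv.apply_symm_apply]
  · rw [Equiv.symm_apply_eq, h2, Equiv.apply_symm_apply]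

theorem Isomorphic.trans {X Y Z : FinBiset G H} :
    Isomorphic X Y → Isomorphic Y Z → Isomorphic X Z := by
  rintro ⟨e, h1, h2⟩ ⟨f, k1, k2⟩
  exact ⟨e.trans f, fun g x => by simp [h1, k1], fun h x => by simp [h2, k2]⟩

/-- A bijective biset map is an isomorphism. -/
theorem Isomorphic.of_bijective {X Y : FinBiset G H} (f : X → Y) (hf : Function.Bijective f)
    (h : IsBisetMap X Y f) : Isomorphic X Y :=
  ⟨Equiv.ofBijective f hf, h.1, h.2⟩

/-- Isomorphism of bisets as an equivalence relation. -/
instance setoid (G H : Type u) [Group G] [Group H] : Setoid (FinBiset G H) where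
  r := Isomorphic
  iseqv := ⟨Isomorphic.refl, Isomorphic.symm, Isomorphic.trans⟩

/-- The empty biset. -/
def empty (G H : Type u) [Group G] [Group H] : FinBiset G H where
  carrier := PEmpty
  left := { smul := fun _ x => x, one_smul := fun _ => rfl, mul_smul := fun _ _ _ => rfl }
  right := { smul := fun _ x => x, one_smul := fun _ => rfl, mul_smul := fun _ _ _ => rfl }
  comm := fun _ _ x => x.elim

/-- The disjoint union of two bisets. -/
def sum (X Y : FinBiset G H) : FinBiset G H where
  carrier := X ⊕ Y
  left :=
    { smul := fun g => Sum.map (g • ·) (g • ·)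
      one_smul := by rintro (x | x) <;> exact congrArg _ (one_smul _ _)
      mul_smul := by rintro _ _ (x | x) <;> exact congrArg _ (mul_smul _ _ _) }
  right :=
    { smul := fun g => Sum.map (g • ·) (g • ·)
      one_smul := by rintro (x | x) <;> exact congrArg _ (one_smul _ _)
      mul_smul := by rintro _ _ (x | x) <;> exact congrArg _ (mul_smul _ _ _) }
  comm := by rintro _ _ (x | x) <;> exact congrArg _ (smul_comm _ _ _).symm

/-- The equivalence relation on `X × Y` whose classes are the orbits of `H` acting by
`h · (x, y) = (x h⁻¹, h y)`. -/
def tensorSetoid (X : FinBiset G H) (Y : FinBiset H K) : Setoid (X × Y) where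
  r a b := ∃ h : H, b = (op h⁻¹ • a.1, h • a.2)
  iseqv :=
    { refl := fun a => ⟨1, by simp⟩
      symm := by
        rintro a b ⟨h, rfl⟩
        exact ⟨h⁻¹, by simp [← mul_smul]⟩
      trans := by
        rintro a b c ⟨h, rfl⟩ ⟨k, rfl⟩
        exact ⟨k * h, by simp [mul_smul]⟩ }

/-- The tensor product `X ×_H Y` of a `(G, H)`-biset and an `(H, K)`-biset. -/
def tensor (X : FinBiset G H) (Y : FinBiset H K) : FinBiset G K where
  carrier := Quotient (tensorSetoid X Y)
  left :=
    { smul := fun g => Quotient.map (sa := tensorSetoid X Y) (sb := tensorSetoid X Y)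
        (fun a => (g • a.1, a.2)) (by
          rintro a b ⟨h, rfl⟩
          exact ⟨h, Prod.ext (smul_comm _ _ _) rfl⟩)
      one_smul := by
        rintro ⟨x, y⟩
        exact congrArg (Quotient.mk (tensorSetoid X Y)) (Prod.ext (one_smul _ _) rfl)
      mul_smul := by
        rintro g h ⟨x, y⟩
        exact congrArg (Quotient.mk (tensorSetoid X Y)) (Prod.ext (mul_smul _ _ _) rfl) }
  right :=
    { smul := fun k => Quotient.map (sa := tensorSetoid X Y) (sb := tensorSetoid X Y)
        (fun a => (a.1, k • a.2)) (by
          rintro a b ⟨h, rfl⟩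
          exact ⟨h, Prod.ext rfl (smul_comm _ _ _).symm⟩)
      one_smul := by
        rintro ⟨x, y⟩
        exact congrArg (Quotient.mk (tensorSetoid X Y)) (Prod.ext rfl (one_smul _ _))
      mul_smul := by
        rintro g h ⟨x, y⟩
        exact congrArg (Quotient.mk (tensorSetoid X Y)) (Prod.ext rfl (mul_smul _ _ _)) }
  comm := by rintro g k ⟨x, y⟩; rfl

/-- The opposite biset `X°`: the same set, with `h · x · g = g⁻¹ x h⁻¹`. -/
def opp (X : FinBiset G H) : FinBiset H G where
  carrier := X
  left :=
    { smul := fun h x => op h⁻¹ • x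
      one_smul := fun x => by
        change op (1 : H)⁻¹ • x = x
        simp
      mul_smul := fun h k x => by
        change op (h * k)⁻¹ • x = op h⁻¹ • op k⁻¹ • x
        rw [← mul_smul, ← op_mul, mul_inv_rev] }
  right :=
    { smul := fun g x => (unop g)⁻¹ • x
      one_smul := fun x => by
        change (unop (1 : Gᵐᵒᵖ))⁻¹ • x = x
        simp
      mul_smul := fun h k x => by
        change (unop (h * k))⁻¹ • x = (unop h)⁻¹ • (unop k)⁻¹ • x
        rw [← mul_smul, unop_mul, mul_inv_rev] }
  comm := fun h g x => smul_comm (g⁻¹ : G) (op h⁻¹) (x : X)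

/-- The `(G, H)`-biset with underlying set `K` and actions `g · x · h = a(g) x b(h)`, for
homomorphisms `a : G → K` and `b : H → K`. -/
def ofHoms [Finite K] (a : G →* K) (b : H →* K) : FinBiset G H where
  carrier := K
  left := MulAction.compHom K a
  right :=
    { smul := fun h x => x * b (unop h)
      one_smul := fun x => by
        change x * b (unop 1) = x
        simp
      mul_smul := fun h k x => by
        change x * b (unop (h * k)) = x * b (unop k) * b (unop h)
        simp [mul_assoc] }
  comm := fun g h x => mul_assoc (a g) x (b h)

/-- The transitive `(G, H)`-biset `G × H / L`, with `g · x · h = (g, h⁻¹) x`. -/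
def ofSubgroup [Finite G] [Finite H] (L : Subgroup (G × H)) : FinBiset G H where
  carrier := (G × H) ⧸ L
  left := MulAction.compHom _ (MonoidHom.inl G H)
  right :=
    { smul := fun h x => ((1, (unop h)⁻¹) : G × H) • x
      one_smul := fun x => by
        change ((1, (unop 1)⁻¹) : G × H) • x = x
        simp [← Prod.one_eq_mk]
      mul_smul := fun h k x => by
        change ((1, (unop (h * k))⁻¹) : G × H) • x
          = ((1, (unop h)⁻¹) : G × H) • ((1, (unop k)⁻¹) : G × H) • x
        simp [← mul_smul] }
  comm := fun g h x => by
    change ((1, h⁻¹) : G × H) • ((g, 1) : G × H) • x = ((g, 1) : G × H) • ((1, h⁻¹) : G × H) • x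
    simp [← mul_smul]

/-- `Id_G`: the set `G` with left and right multiplication. -/
def identity (G : Type u) [Group G] [Finite G] : FinBiset G G :=
  ofHoms (MonoidHom.id G) (MonoidHom.id G)

/-- Inflation: the set `G / N` as a `(G, G / N)`-biset. -/
def inflation [Finite G] (N : Subgroup G) [N.Normal] : FinBiset G (G ⧸ N) :=
  ofHoms (QuotientGroup.mk' N) (MonoidHom.id (G ⧸ N))

/-- Deflation: the set `G / N` as a `(G / N, G)`-biset. -/
def deflation [Finite G] (N : Subgroup G) [N.Normal] : FinBiset (G ⧸ N) G :=
  ofHoms (MonoidHom.id (G ⧸ N)) (QuotientGroup.mk' N)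

/-! Isomorphisms needed to define the operations on classes. -/

theorem sum_congr {X X' Y Y' : FinBiset G H} :
    Isomorphic X X' → Isomorphic Y Y' → Isomorphic (sum X Y) (sum X' Y') := by
  rintro ⟨e, h1, h2⟩ ⟨f, k1, k2⟩
  refine ⟨Equiv.sumCongr e f, ?_, ?_⟩
  · rintro g (x | x)
    · exact congrArg Sum.inl (h1 g x)
    · exact congrArg Sum.inr (k1 g x)
  · rintro g (x | x)
    · exact congrArg Sum.inl (h2 g x)
    · exact congrArg Sum.inr (k2 g x)

theorem sum_comm (X Y : FinBiset G H) : Isomorphic (sum X Y) (sum Y X) :=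
  ⟨Equiv.sumComm _ _, by rintro g (x | x) <;> rfl, by rintro g (x | x) <;> rfl⟩

theorem sum_assoc (X Y Z : FinBiset G H) :
    Isomorphic (sum (sum X Y) Z) (sum X (sum Y Z)) :=
  ⟨Equiv.sumAssoc _ _ _, by rintro g ((x | x) | x) <;> rfl, by rintro g ((x | x) | x) <;> rfl⟩

theorem empty_sum (X : FinBiset G H) : Isomorphic (sum (empty G H) X) X :=
  ⟨Equiv.emptySum PEmpty X, by rintro g (x | x); exacts [x.elim, rfl],
    by rintro g (x | x); exacts [x.elim, rfl]⟩

theorem opp_congr {X Y : FinBiset G H} : Isomorphic X Y → Isomorphic (opp X) (opp Y) := by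
  rintro ⟨e, h1, h2⟩
  exact ⟨e, fun h x => h2 h⁻¹ x, fun g x => h1 g⁻¹ x⟩

theorem opp_empty : Isomorphic (opp (empty G H)) (empty H G) :=
  ⟨Equiv.refl PEmpty, fun _ x => x.elim, fun _ x => x.elim⟩

theorem opp_sum (X Y : FinBiset G H) : Isomorphic (opp (sum X Y)) (sum (opp X) (opp Y)) :=
  ⟨Equiv.refl _, by rintro g (x | x) <;> rfl, by rintro g (x | x) <;> rfl⟩

theorem opp_opp (X : FinBiset G H) : Isomorphic (opp (opp X)) X := by
  refine ⟨Equiv.refl X, fun g (x : X) => ?_, fun h (x : X) => ?_⟩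
  · change (g⁻¹)⁻¹ • x = g • x
    rw [inv_inv]
  · change op (h⁻¹)⁻¹ • x = op h • x
    rw [inv_inv]

theorem tensor_eq {X : FinBiset G H} {Y : FinBiset H K} (h : H) (x : X) (y : Y) :
    (Quotient.mk (tensorSetoid X Y) (op h • x, y)) =
      Quotient.mk (tensorSetoid X Y) (x, h • y) :=
  Quotient.sound ⟨h, by simp [← mul_smul]⟩

theorem tensor_congr {X X' : FinBiset G H} {Y Y' : FinBiset H K} :
    Isomorphic X X' → Isomorphic Y Y' → Isomorphic (tensor X Y) (tensor X' Y') := by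
  rintro ⟨e, h1, h2⟩ ⟨f, k1, k2⟩
  refine ⟨Quotient.congr (ra := tensorSetoid X Y) (rb := tensorSetoid X' Y')
    (Equiv.prodCongr e f) ?_, ?_, ?_⟩
  · rintro ⟨x, y⟩ ⟨x', y'⟩
    constructor
    · rintro ⟨h, hh⟩
      obtain ⟨rfl, rfl⟩ := Prod.ext_iff.1 hh
      exact ⟨h, Prod.ext (h2 _ _) (k1 _ _)⟩
    · rintro ⟨h, hh⟩
      obtain ⟨p, q⟩ := Prod.ext_iff.1 hh
      refine ⟨h, Prod.ext ?_ ?_⟩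
      · exact e.injective (p.trans (h2 _ _).symm)
      · exact f.injective (q.trans (k1 _ _).symm)
  · rintro g ⟨x, y⟩
    exact congrArg (Quotient.mk (tensorSetoid X' Y')) (Prod.ext (h1 _ _) rfl)
  · rintro g ⟨x, y⟩
    exact congrArg (Quotient.mk (tensorSetoid X' Y')) (Prod.ext rfl (k2 _ _))

theorem tensor_assoc (X : FinBiset G H) (Y : FinBiset H K) (Z : FinBiset K L) :
    Isomorphic (tensor (tensor X Y) Z) (tensor X (tensor Y Z)) := by
  let F : tensor (tensor X Y) Z → tensor X (tensor Y Z) :=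
    Quotient.lift (s := tensorSetoid (tensor X Y) Z)
      (fun a => Quotient.lift (s := tensorSetoid X Y)
        (fun b => Quotient.mk (tensorSetoid X (tensor Y Z))
          (b.1, Quotient.mk (tensorSetoid Y Z) (b.2, a.2)))
        (by
          rintro ⟨x, y⟩ _ ⟨h, rfl⟩
          exact Quotient.sound ⟨h, rfl⟩) a.1)
      (by
        rintro ⟨⟨x, y⟩, z⟩ _ ⟨k, rfl⟩
        refine congrArg (fun t => Quotient.mk (tensorSetoid X (tensor Y Z)) (x, t)) ?_
        exact Quotient.sound ⟨k, rfl⟩)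
  let F' : tensor X (tensor Y Z) → tensor (tensor X Y) Z :=
    Quotient.lift (s := tensorSetoid X (tensor Y Z))
      (fun a => Quotient.lift (s := tensorSetoid Y Z)
        (fun b => Quotient.mk (tensorSetoid (tensor X Y) Z)
          (Quotient.mk (tensorSetoid X Y) (a.1, b.1), b.2))
        (by
          rintro ⟨x, y⟩ _ ⟨h, rfl⟩
          exact Quotient.sound ⟨h, rfl⟩) a.2)
      (by
        rintro ⟨x, ⟨y, z⟩⟩ _ ⟨k, rfl⟩
        refine congrArg (fun t => Quotient.mk (tensorSetoid (tensor X Y) Z) (t, z)) ?_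
        exact Quotient.sound ⟨k, rfl⟩)
  refine ⟨⟨F, F', ?_, ?_⟩, ?_, ?_⟩
  · rintro ⟨⟨x, y⟩, z⟩; rfl
  · rintro ⟨x, ⟨y, z⟩⟩; rfl
  · rintro g ⟨⟨x, y⟩, z⟩; rfl
  · rintro g ⟨⟨x, y⟩, z⟩; rfl

theorem opp_tensor (X : FinBiset G H) (Y : FinBiset H K) :
    Isomorphic (opp (tensor X Y)) (tensor (opp Y) (opp X)) := by
  refine ⟨Quotient.congr (ra := tensorSetoid X Y) (rb := tensorSetoid (opp Y) (opp X))
    (Equiv.prodComm X Y) ?_, ?_, ?_⟩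
  · rintro ⟨x, y⟩ ⟨x', y'⟩
    constructor
    · rintro ⟨h, hh⟩
      obtain ⟨rfl, rfl⟩ := Prod.ext_iff.1 hh
      refine ⟨h, Prod.ext ?_ rfl⟩
      change h • y = (h⁻¹)⁻¹ • y
      rw [inv_inv]
    · rintro ⟨h, hh⟩
      obtain ⟨p, q⟩ := Prod.ext_iff.1 hh
      refine ⟨h, Prod.ext q ?_⟩
      refine (show y' = (h⁻¹)⁻¹ • y from p).trans ?_
      rw [inv_inv]
  · rintro g ⟨x, y⟩; rfl
  · rintro g ⟨x, y⟩; rfl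

theorem empty_tensor (Y : FinBiset H K) : Isomorphic (tensor (empty G H) Y) (empty G K) := by
  have : IsEmpty (tensor (empty G H) Y) := ⟨by rintro ⟨x, y⟩; exact x.elim⟩
  have : IsEmpty (empty G K) := inferInstanceAs (IsEmpty PEmpty)
  exact ⟨Equiv.equivOfIsEmpty _ _, fun _ x => isEmptyElim x, fun _ x => isEmptyElim x⟩

theorem sum_tensor (X X' : FinBiset G H) (Y : FinBiset H K) :
    Isomorphic (tensor (sum X X') Y) (sum (tensor X Y) (tensor X' Y)) := by
  let F : tensor (sum X X') Y → sum (tensor X Y) (tensor X' Y) :=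
    Quotient.lift (s := tensorSetoid (sum X X') Y)
      (fun a => Sum.map (fun x => Quotient.mk (tensorSetoid X Y) (x, a.2))
        (fun x => Quotient.mk (tensorSetoid X' Y) (x, a.2)) a.1)
      (by
        rintro ⟨x | x, y⟩ _ ⟨h, rfl⟩
        · exact congrArg Sum.inl (Quotient.sound ⟨h, rfl⟩)
        · exact congrArg Sum.inr (Quotient.sound ⟨h, rfl⟩))
  let F' : sum (tensor X Y) (tensor X' Y) → tensor (sum X X') Y :=
    Sum.elim
      (Quotient.lift (s := tensorSetoid X Y)
        (fun a => Quotient.mk (tensorSetoid (sum X X') Y) (Sum.inl a.1, a.2))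
        (by
          rintro ⟨x, y⟩ _ ⟨h, rfl⟩
          exact Quotient.sound ⟨h, rfl⟩))
      (Quotient.lift (s := tensorSetoid X' Y)
        (fun a => Quotient.mk (tensorSetoid (sum X X') Y) (Sum.inr a.1, a.2))
        (by
          rintro ⟨x, y⟩ _ ⟨h, rfl⟩
          exact Quotient.sound ⟨h, rfl⟩))
  refine ⟨⟨F, F', ?_, ?_⟩, ?_, ?_⟩
  · rintro ⟨x | x, y⟩ <;> rfl
  · rintro (⟨x, y⟩ | ⟨x, y⟩) <;> rfl
  · rintro g ⟨x | x, y⟩ <;> rfl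
  · rintro g ⟨x | x, y⟩ <;> rfl

theorem tensor_empty (X : FinBiset G H) : Isomorphic (tensor X (empty H K)) (empty G K) := by
  have : IsEmpty (tensor X (empty H K)) := ⟨by rintro ⟨x, y⟩; exact y.elim⟩
  have : IsEmpty (empty G K) := inferInstanceAs (IsEmpty PEmpty)
  exact ⟨Equiv.equivOfIsEmpty _ _, fun _ x => isEmptyElim x, fun _ x => isEmptyElim x⟩

theorem tensor_sum (X : FinBiset G H) (Y Y' : FinBiset H K) :
    Isomorphic (tensor X (sum Y Y')) (sum (tensor X Y) (tensor X Y')) := by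
  let F : tensor X (sum Y Y') → sum (tensor X Y) (tensor X Y') :=
    Quotient.lift (s := tensorSetoid X (sum Y Y'))
      (fun a => Sum.map (fun y => Quotient.mk (tensorSetoid X Y) (a.1, y))
        (fun y => Quotient.mk (tensorSetoid X Y') (a.1, y)) a.2)
      (by
        rintro ⟨x, y | y⟩ _ ⟨h, rfl⟩
        · exact congrArg Sum.inl (Quotient.sound ⟨h, rfl⟩)
        · exact congrArg Sum.inr (Quotient.sound ⟨h, rfl⟩))
  let F' : sum (tensor X Y) (tensor X Y') → tensor X (sum Y Y') :=
    Sum.elim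
      (Quotient.lift (s := tensorSetoid X Y)
        (fun a => Quotient.mk (tensorSetoid X (sum Y Y')) (a.1, Sum.inl a.2))
        (by
          rintro ⟨x, y⟩ _ ⟨h, rfl⟩
          exact Quotient.sound ⟨h, rfl⟩))
      (Quotient.lift (s := tensorSetoid X Y')
        (fun a => Quotient.mk (tensorSetoid X (sum Y Y')) (a.1, Sum.inr a.2))
        (by
          rintro ⟨x, y⟩ _ ⟨h, rfl⟩
          exact Quotient.sound ⟨h, rfl⟩))
  refine ⟨⟨F, F', ?_, ?_⟩, ?_, ?_⟩
  · rintro ⟨x, y | y⟩ <;> rfl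
  · rintro (⟨x, y⟩ | ⟨x, y⟩) <;> rfl
  · rintro g ⟨x, y | y⟩ <;> rfl
  · rintro g ⟨x, y | y⟩ <;> rfl

theorem identity_tensor [Finite G] (X : FinBiset G H) :
    Isomorphic (tensor (identity G) X) X := by
  let F : tensor (identity G) X → X :=
    Quotient.lift (s := tensorSetoid (identity G) X) (fun a => (show G from a.1) • a.2) (by
      rintro ⟨(g : G), x⟩ _ ⟨h, rfl⟩
      change g • x = (g * h⁻¹) • h • x
      simp [← mul_smul])
  refine ⟨⟨F, fun x => Quotient.mk (tensorSetoid (identity G) X) ((1 : G), x), ?_, ?_⟩, ?_, ?_⟩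
  · rintro ⟨(g : G), x⟩
    refine (tensor_eq (X := identity G) g (1 : G) x).symm.trans ?_
    exact congrArg (fun t => Quotient.mk (tensorSetoid (identity G) X) (t, x))
      (one_mul g)
  · intro x
    exact one_smul G x
  · rintro g ⟨h, x⟩
    exact mul_smul g (show G from h) x
  · rintro g ⟨h, x⟩
    exact smul_comm (show G from h) (op g) x

theorem opp_identity [Finite G] : Isomorphic (opp (identity G)) (identity G) :=
  ⟨Equiv.inv G, fun g (x : G) => by
    change (x * g⁻¹)⁻¹ = g * x⁻¹
    simp, fun g (x : G) => by
    change (g⁻¹ * x)⁻¹ = x⁻¹ * g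
    simp⟩

theorem tensor_identity [Finite H] (X : FinBiset G H) :
    Isomorphic (tensor X (identity H)) X :=
  (opp_opp _).symm.trans <| (opp_congr <| (opp_tensor _ _).trans <|
    (tensor_congr opp_identity (Isomorphic.refl _)).trans (identity_tensor _)).trans (opp_opp X)

theorem opp_ofHoms [Finite K] (a : G →* K) (b : H →* K) :
    Isomorphic (opp (ofHoms a b)) (ofHoms b a) :=
  ⟨Equiv.inv K, fun g (x : K) => by
    change (x * b g⁻¹)⁻¹ = b g * x⁻¹
    simp, fun g (x : K) => by
    change (a g⁻¹ * x)⁻¹ = x⁻¹ * a g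
    simp⟩

theorem deflation_tensor_inflation [Finite G] (N : Subgroup G) [N.Normal] :
    Isomorphic (tensor (deflation N) (inflation N)) (identity (G ⧸ N)) := by
  let F : tensor (deflation N) (inflation N) → identity (G ⧸ N) :=
    Quotient.lift (s := tensorSetoid (deflation N) (inflation N))
      (fun a => (show G ⧸ N from a.1) * (show G ⧸ N from a.2)) (by
      rintro ⟨(x : G ⧸ N), (y : G ⧸ N)⟩ _ ⟨h, rfl⟩
      change x * y = (x * QuotientGroup.mk' N h⁻¹) * (QuotientGroup.mk' N h * y)
      simp [mul_assoc])
  refine ⟨⟨F, fun x => Quotient.mk (tensorSetoid (deflation N) (inflation N))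
    ((1 : G ⧸ N), (x : G ⧸ N)), ?_, ?_⟩, ?_, ?_⟩
  · rintro ⟨x, y⟩
    obtain ⟨g, hg⟩ := QuotientGroup.mk'_surjective N x
    subst hg
    refine (tensor_eq (X := deflation N) (Y := inflation N) g (1 : G ⧸ N) y).symm.trans ?_
    exact congrArg (fun t => Quotient.mk (tensorSetoid (deflation N) (inflation N)) (t, y))
      (one_mul (QuotientGroup.mk' N g))
  · intro x
    exact one_mul (show G ⧸ N from x)
  · rintro g ⟨x, y⟩
    exact mul_assoc g (show G ⧸ N from x) (show G ⧸ N from y)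
  · rintro g ⟨x, y⟩
    exact (mul_assoc (show G ⧸ N from x) (show G ⧸ N from y) g).symm

end FinBiset

/-! ### The Burnside groups `B(G, H)` -/

open FinBiset

/-- Isomorphism classes of finite `(G, H)`-bisets. -/
def BisetClass (G H : Type u) [Group G] [Group H] : Type (u + 1) :=
  Quotient (FinBiset.setoid G H)

section BisetClass

variable {G H K L : Type u} [Group G] [Group H] [Group K] [Group L]

/-- Isomorphism classes form a commutative monoid under disjoint union. -/
instance : Add (BisetClass G H) :=
  ⟨Quotient.map₂ sum fun _ _ h _ _ k => sum_congr h k⟩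

instance : Zero (BisetClass G H) := ⟨Quotient.mk _ (empty G H)⟩

instance : AddCommMonoid (BisetClass G H) where
  add_assoc := by
    rintro ⟨X⟩ ⟨Y⟩ ⟨Z⟩
    exact Quotient.sound (sum_assoc X Y Z)
  add_comm := by
    rintro ⟨X⟩ ⟨Y⟩
    exact Quotient.sound (sum_comm X Y)
  zero_add := by
    rintro ⟨X⟩
    exact Quotient.sound (empty_sum X)
  add_zero := by
    rintro ⟨X⟩
    exact Quotient.sound ((sum_comm _ _).trans (empty_sum X))
  nsmul := nsmulRec

/-- The tensor product on isomorphism classes. -/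
def BisetClass.tensor : BisetClass G H →+ BisetClass H K →+ BisetClass G K where
  toFun x :=
    { toFun := fun y => Quotient.map₂ FinBiset.tensor (fun _ _ h _ _ k => tensor_congr h k) x y
      map_zero' := by
        obtain ⟨X⟩ := x
        exact Quotient.sound (tensor_empty X)
      map_add' := by
        obtain ⟨X⟩ := x
        rintro ⟨Y⟩ ⟨Z⟩
        exact Quotient.sound (tensor_sum X Y Z) }
  map_zero' := by
    ext ⟨Y⟩
    exact Quotient.sound (empty_tensor Y)
  map_add' := by
    rintro ⟨X⟩ ⟨Y⟩
    ext ⟨Z⟩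
    exact Quotient.sound (sum_tensor X Y Z)

/-- Opposites on isomorphism classes. -/
def BisetClass.opp : BisetClass G H →+ BisetClass H G where
  toFun := Quotient.map FinBiset.opp fun _ _ h => opp_congr h
  map_zero' := Quotient.sound opp_empty
  map_add' := by
    rintro ⟨X⟩ ⟨Y⟩
    exact Quotient.sound (opp_sum X Y)

end BisetClass

/-- The Burnside group `B(G, H)`: the Grothendieck group of isomorphism classes of finite
`(G, H)`-bisets with respect to disjoint union. -/
def B (G H : Type u) [Group G] [Group H] : Type (u + 1) :=
  Algebra.GrothendieckAddGroup (BisetClass G H)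

namespace B

noncomputable section

variable {G H K L : Type u} [Group G] [Group H] [Group K] [Group L]

instance : AddCommGroup (B G H) :=
  inferInstanceAs (AddCommGroup (Algebra.GrothendieckAddGroup (BisetClass G H)))

/-- The canonical map from isomorphism classes to the Grothendieck group. -/
def ofClass : BisetClass G H →+ B G H :=
  Algebra.GrothendieckAddGroup.of (M := BisetClass G H)

/-- The class `[X]` in `B(G, H)` of a finite biset `X`. -/
def mk (X : FinBiset G H) : B G H := ofClass (Quotient.mk (FinBiset.setoid G H) X)

theorem mk_eq {X Y : FinBiset G H} (h : Isomorphic X Y) : mk X = mk Y :=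
  congrArg ofClass (Quotient.sound h)

/-- The universal property of the Grothendieck group. -/
def lift {A : Type*} [AddCommGroup A] (f : BisetClass G H →+ A) : B G H →+ A :=
  Algebra.GrothendieckAddGroup.lift f

theorem lift_ofClass {A : Type*} [AddCommGroup A] (f : BisetClass G H →+ A)
    (x : BisetClass G H) : lift f (ofClass x) = f x :=
  DFunLike.congr_fun (Algebra.GrothendieckAddGroup.lift.symm_apply_apply f) x

theorem hom_ext {A : Type*} [AddCommGroup A] {f g : B G H →+ A}
    (h : ∀ X : FinBiset G H, f (mk X) = g (mk X)) : f = g := by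
  apply (Algebra.GrothendieckAddGroup.lift (M := BisetClass G H) (G := A)).symm.injective
  ext ⟨X⟩
  exact h X

/-- The bilinear composition `B(G, H) × B(H, K) → B(G, K)` with `[X] ∘ [Y] = [X ×_H Y]`. -/
def comp : B G H →+ B H K →+ B G K :=
  lift
    { toFun := fun x => lift (ofClass.comp (BisetClass.tensor x))
      map_zero' := by
        refine hom_ext fun X => (lift_ofClass _ _).trans ?_
        rw [map_zero]
        exact map_zero ofClass
      map_add' := fun x y => by
        refine hom_ext fun X => (lift_ofClass _ _).trans ?_
        rw [map_add]
        refine (map_add ofClass _ _).trans ?_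
        exact (congrArg₂ (· + ·) (lift_ofClass (ofClass.comp (BisetClass.tensor x)) _)
          (lift_ofClass (ofClass.comp (BisetClass.tensor y)) _)).symm }

theorem comp_mk (X : FinBiset G H) (Y : FinBiset H K) :
    comp (mk X) (mk Y) = mk (FinBiset.tensor X Y) := by
  exact (DFunLike.congr_fun (lift_ofClass _ _) _).trans (lift_ofClass _ _)

/-- The duality `B(G, H) → B(H, G)` with `[X]° = [X°]`. -/
def dual : B G H →+ B H G := lift (ofClass.comp BisetClass.opp)

theorem dual_mk (X : FinBiset G H) : dual (mk X) = mk (opp X) := lift_ofClass _ _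

theorem comp_assoc (a : B G H) (b : B H K) (c : B K L) :
    comp (comp a b) c = comp a (comp b c) := by
  let P : B G H →+ B H K →+ B K L →+ B G L :=
    (AddMonoidHom.compHom (comp (G := G) (H := K) (K := L))).comp comp
  let Q : B G H →+ B H K →+ B K L →+ B G L :=
    { toFun := fun a =>
        (AddMonoidHom.compHom (comp (K := L) a)).comp (comp (G := H) (H := K) (K := L))
      map_zero' := by ext; simp
      map_add' := fun a b => by ext; simp }
  have : P = Q := by
    refine hom_ext fun X => hom_ext fun Y => hom_ext fun Z => ?_
    change comp (comp (mk X) (mk Y)) (mk Z) = comp (mk X) (comp (mk Y) (mk Z))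
    simp only [comp_mk]
    exact mk_eq (tensor_assoc X Y Z)
  exact DFunLike.congr_fun (DFunLike.congr_fun (DFunLike.congr_fun this a) b) c

theorem dual_dual (a : B G H) : dual (dual a) = a := by
  have : (dual (G := H) (H := G)).comp dual = AddMonoidHom.id (B G H) :=
    hom_ext fun X => by simp [dual_mk, mk_eq (opp_opp X)]
  exact DFunLike.congr_fun this a

theorem dual_comp (a : B G H) (b : B H K) : dual (comp a b) = comp (dual b) (dual a) := by
  let P : B G H →+ B H K →+ B K G := (AddMonoidHom.compHom dual).comp comp
  let Q : B G H →+ B H K →+ B K G :=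
    { toFun := fun a => ((comp (G := K) (H := H) (K := G)).flip (dual a)).comp dual
      map_zero' := by ext; simp
      map_add' := fun a b => by ext; simp }
  have : P = Q := by
    refine hom_ext fun X => hom_ext fun Y => ?_
    change dual (comp (mk X) (mk Y)) = comp (dual (mk Y)) (dual (mk X))
    simp only [comp_mk, dual_mk]
    exact mk_eq (opp_tensor X Y)
  exact DFunLike.congr_fun (DFunLike.congr_fun this a) b

theorem id_comp [Finite G] (a : B G H) : comp (mk (identity G)) a = a := by
  have : comp (K := H) (mk (identity G)) = AddMonoidHom.id (B G H) :=
    hom_ext fun X => by simp [comp_mk, mk_eq (identity_tensor X)]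
  exact DFunLike.congr_fun this a

theorem comp_id [Finite H] (a : B G H) : comp a (mk (identity H)) = a := by
  have : (comp (G := G)).flip (mk (identity H)) = AddMonoidHom.id (B G H) :=
    hom_ext fun X => by simp [comp_mk, mk_eq (tensor_identity X)]
  exact DFunLike.congr_fun this a

/-- The double Burnside ring `B(G, G)`, with multiplication `[X][Y] = [X ×_G Y]`. -/
instance instRing [Finite G] : Ring (B G G) where
  __ := (inferInstance : AddCommGroup (B G G))
  mul a b := comp a b
  one := mk (identity G)
  mul_assoc := comp_assoc
  one_mul := id_comp
  mul_one := comp_id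
  left_distrib a b c := map_add (comp a) b c
  right_distrib a b c := DFunLike.congr_fun (map_add comp a b) c
  zero_mul a := DFunLike.congr_fun (map_zero comp) a
  mul_zero a := map_zero (comp a)

theorem mul_def [Finite G] (a b : B G G) : a * b = comp a b := rfl

theorem one_def [Finite G] : (1 : B G G) = mk (identity G) := rfl

theorem dual_mul [Finite G] (a b : B G G) : dual (a * b) = dual b * dual a := dual_comp a b

theorem dual_one [Finite G] : dual (1 : B G G) = 1 := by
  rw [one_def, dual_mk, mk_eq opp_identity]

/-- `Inf_{G/N}^G` as an element of `B(G, G/N)`. -/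
def Inf [Finite G] (N : Subgroup G) [N.Normal] : B G (G ⧸ N) := mk (inflation N)

/-- `Def_{G/N}^G` as an element of `B(G/N, G)`. -/
def Def [Finite G] (N : Subgroup G) [N.Normal] : B (G ⧸ N) G := mk (deflation N)

theorem Def_comp_Inf [Finite G] (N : Subgroup G) [N.Normal] : comp (Def N) (Inf N) = 1 := by
  rw [Def, Inf, comp_mk, one_def, mk_eq (deflation_tensor_inflation N)]

theorem dual_Inf [Finite G] (N : Subgroup G) [N.Normal] : dual (Inf N) = Def N := by
  rw [Inf, dual_mk]
  exact mk_eq (opp_ofHoms _ _)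

theorem dual_Def [Finite G] (N : Subgroup G) [N.Normal] : dual (Def N) = Inf N := by
  rw [← dual_Inf, dual_dual]

/-- The additive map `B(G/N, G/N) → B(G, G)`, `a ↦ Inf ∘ a ∘ Def`. -/
def inflate [Finite G] (N : Subgroup G) [N.Normal] : B (G ⧸ N) (G ⧸ N) →+ B G G :=
  ((comp (G := G) (H := G ⧸ N) (K := G)).flip (Def N)).comp (comp (Inf N))

theorem inflate_apply [Finite G] (N : Subgroup G) [N.Normal] (a : B (G ⧸ N) (G ⧸ N)) :
    inflate N a = comp (comp (Inf N) a) (Def N) := rfl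

theorem inflate_mul [Finite G] (N : Subgroup G) [N.Normal] (a b : B (G ⧸ N) (G ⧸ N)) :
    inflate N (a * b) = inflate N a * inflate N b := by
  have h : comp (Def N) (comp (comp (Inf N) b) (Def N)) = comp b (Def N) := by
    rw [← comp_assoc, ← comp_assoc, Def_comp_Inf]
    exact congrArg (fun t => comp t (Def N)) (one_mul b)
  rw [mul_def, mul_def, inflate_apply, inflate_apply, inflate_apply, comp_assoc _ (Def N), h,
    ← comp_assoc, ← comp_assoc]

theorem dual_inflate [Finite G] (N : Subgroup G) [N.Normal] (a : B (G ⧸ N) (G ⧸ N)) :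
    dual (inflate N a) = inflate N (dual a) := by
  rw [inflate_apply, inflate_apply, dual_comp, dual_comp, dual_Inf, dual_Def, comp_assoc]

/-- `dBInf_{G/N}^G : B(G/N, G/N)ˣ → B(G, G)ˣ`, `u ↦ 1 + Inf ∘ (u - 1) ∘ Def`. -/
def dBInf [Finite G] (N : Subgroup G) [N.Normal] : (B (G ⧸ N) (G ⧸ N))ˣ →* (B G G)ˣ :=
  Units.map
    { toFun := fun u => 1 + inflate N (u - 1)
      map_one' := by simp
      map_mul' := fun u v => by
        have h : u * v - 1 = (u - 1) + (v - 1) + (u - 1) * (v - 1) := by noncomm_ring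
        rw [h, map_add, map_add, inflate_mul]
        noncomm_ring }

theorem coe_dBInf [Finite G] (N : Subgroup G) [N.Normal] (u : (B (G ⧸ N) (G ⧸ N))ˣ) :
    (dBInf N u : B G G) = 1 + inflate N ((u : B (G ⧸ N) (G ⧸ N)) - 1) := rfl

/-- `B_∘(G, G)`, the group of orthogonal units of `B(G, G)`: units `u` with
`u u° = u° u = Id_G`. -/
def orthogonalUnits (G : Type u) [Group G] [Finite G] : Subgroup (B G G)ˣ where
  carrier := {u | (u : B G G) * dual (u : B G G) = 1 ∧ dual (u : B G G) * (u : B G G) = 1}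
  one_mem' := by simp [dual_one]
  mul_mem' := by
    rintro u v ⟨h1, h2⟩ ⟨k1, k2⟩
    constructor
    · rw [Units.val_mul, dual_mul, mul_assoc, ← mul_assoc (v : B G G), k1, one_mul, h1]
    · rw [Units.val_mul, dual_mul, mul_assoc, ← mul_assoc (dual (u : B G G)), h2, one_mul, k2]
  inv_mem' := by
    rintro u ⟨h1, h2⟩
    have e : ((u⁻¹ : (B G G)ˣ) : B G G) = dual (u : B G G) :=
      (Units.inv_eq_of_mul_eq_one_right h1)
    change _ * _ = _ ∧ _ * _ = _
    rw [e, dual_dual]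
    exact ⟨h2, h1⟩

theorem mem_orthogonalUnits [Finite G] {u : (B G G)ˣ} : u ∈ orthogonalUnits G ↔
    (u : B G G) * dual (u : B G G) = 1 ∧ dual (u : B G G) * (u : B G G) = 1 := Iff.rfl

theorem dBInf_mem [Finite G] (N : Subgroup G) [N.Normal] {u : (B (G ⧸ N) (G ⧸ N))ˣ}
    (hu : u ∈ orthogonalUnits (G ⧸ N)) : dBInf N u ∈ orthogonalUnits G := by
  obtain ⟨h1, h2⟩ := hu
  have e : dual (u : B (G ⧸ N) (G ⧸ N)) = ((u⁻¹ : (B (G ⧸ N) (G ⧸ N))ˣ) : B (G ⧸ N) (G ⧸ N)) :=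
    (Units.inv_eq_of_mul_eq_one_right h1).symm
  have d : dual (dBInf N u : B G G) = ((dBInf N u)⁻¹ : (B G G)ˣ) := by
    rw [← map_inv, coe_dBInf, coe_dBInf, map_add, dual_one, dual_inflate, map_sub, dual_one, e]
  rw [mem_orthogonalUnits, d]
  exact ⟨Units.mul_inv _, Units.inv_mul _⟩

/-- The restriction `dBInf_{G/N}^G : B_∘(G/N, G/N) → B_∘(G, G)`. -/
def dBInfOrthogonal [Finite G] (N : Subgroup G) [N.Normal] :
    orthogonalUnits (G ⧸ N) →* orthogonalUnits G :=
  ((dBInf N).comp (orthogonalUnits (G ⧸ N)).subtype).codRestrict (orthogonalUnits G)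
    fun u => dBInf_mem N u.2

end

end B

/-! ### Outer automorphisms and the maps `η` and `ρ` -/

instance conj_range_normal (G : Type u) [Group G] :
    ((MulAut.conj : G →* MulAut G).range).Normal where
  conj_mem := by
    rintro _ ⟨g, rfl⟩ φ
    refine ⟨φ g, ?_⟩
    ext x
    simp [MulAut.conj_apply]

/-- `Out(G) = Aut(G) / Inn(G)`. -/
abbrev Out (G : Type u) [Group G] : Type u := MulAut G ⧸ (MulAut.conj : G →* MulAut G).range

/-- The group ring `ℤ Out(G)`. -/
abbrev ZOut (G : Type u) [Group G] : Type u := MonoidAlgebra ℤ (Out G)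

/-- `Δ_φ(G) = {(φ(h), h) | h ∈ G}`, the subgroup of `G × G` encoded by `(G, 1, φ, G, 1)`. -/
def graph {G : Type u} [Group G] (φ : MulAut G) : Subgroup (G × G) :=
  (MonoidHom.prod φ.toMonoidHom (MonoidHom.id G)).range

noncomputable section

variable {G : Type u} [Group G]

theorem mem_graph {φ : MulAut G} {a : G × G} : a ∈ graph φ ↔ a.1 = φ a.2 := by
  constructor
  · rintro ⟨h, rfl⟩
    rfl
  · intro h
    exact ⟨a.2, Prod.ext h.symm rfl⟩

/-- `G × G / Δ_φ(G)` is the set `G` with `g · x · h = g x φ(h)`. -/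
theorem ofSubgroup_graph [Finite G] (φ : MulAut G) :
    FinBiset.Isomorphic (FinBiset.ofSubgroup (graph φ))
      (FinBiset.ofHoms (MonoidHom.id G) φ.toMonoidHom) := by
  let F : FinBiset.ofSubgroup (graph φ) → FinBiset.ofHoms (MonoidHom.id G) φ.toMonoidHom :=
    Quotient.lift (s := QuotientGroup.leftRel (graph φ)) (fun a => a.1 * φ a.2⁻¹) (by
      intro a b hab
      have h := mem_graph.1 (QuotientGroup.leftRel_apply.1 hab)
      have h' : a.1⁻¹ * b.1 = (φ a.2)⁻¹ * φ b.2 := by simpa using h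
      have h'' : b.1 = a.1 * ((φ a.2)⁻¹ * φ b.2) := by rw [← h']; group
      change a.1 * φ a.2⁻¹ = b.1 * φ b.2⁻¹
      rw [h'']
      simp [mul_assoc])
  refine ⟨⟨F, fun (x : G) => QuotientGroup.mk (x, (1 : G)), ?_, ?_⟩, ?_, ?_⟩
  · rintro ⟨a⟩
    refine QuotientGroup.eq.2 (mem_graph.2 ?_)
    change (a.1 * φ a.2⁻¹)⁻¹ * a.1 = φ (1⁻¹ * a.2)
    simp
  · intro (x : G)
    change x * φ 1⁻¹ = x
    simp
  · rintro g ⟨a⟩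
    change g * a.1 * φ (1 * a.2)⁻¹ = g * (a.1 * φ a.2⁻¹)
    simp [mul_assoc]
  · rintro g ⟨a⟩
    change 1 * a.1 * φ (g⁻¹ * a.2)⁻¹ = a.1 * φ a.2⁻¹ * φ g
    simp [mul_assoc]

theorem ofHoms_tensor [Finite G] (φ ψ : MulAut G) : FinBiset.Isomorphic
    (FinBiset.tensor (FinBiset.ofHoms (MonoidHom.id G) φ.toMonoidHom)
      (FinBiset.ofHoms (MonoidHom.id G) ψ.toMonoidHom))
    (FinBiset.ofHoms (MonoidHom.id G) (φ * ψ).toMonoidHom) := by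
  let X := FinBiset.ofHoms (MonoidHom.id G) φ.toMonoidHom
  let Y := FinBiset.ofHoms (MonoidHom.id G) ψ.toMonoidHom
  let F : FinBiset.tensor X Y → FinBiset.ofHoms (MonoidHom.id G) (φ * ψ).toMonoidHom :=
    Quotient.lift (s := FinBiset.tensorSetoid X Y)
      (fun a => (show G from a.1) * φ (show G from a.2)) (by
      rintro ⟨(x : G), (y : G)⟩ _ ⟨h, rfl⟩
      change x * φ y = (x * φ h⁻¹) * φ (h * y)
      simp [mul_assoc])
  refine ⟨⟨F, fun x => Quotient.mk (FinBiset.tensorSetoid X Y)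
    ((show G from x), (1 : G)), ?_, ?_⟩, ?_, ?_⟩
  · rintro ⟨x, y⟩
    refine (FinBiset.tensor_eq (X := X) (Y := Y) (show G from y) x (1 : G)).trans ?_
    exact congrArg (fun t => Quotient.mk (FinBiset.tensorSetoid X Y) (x, t))
      (mul_one (show G from y))
  · intro (x : G)
    change x * φ 1 = x
    simp
  · rintro g ⟨x, y⟩
    exact mul_assoc g (show G from x) (φ (show G from y))
  · rintro g ⟨(x : G), (y : G)⟩
    change x * φ (y * ψ g) = x * φ y * φ (ψ g)
    simp [mul_assoc]

theorem ofHoms_conj [Finite G] (φ : MulAut G) (c : G) : FinBiset.Isomorphic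
    (FinBiset.ofHoms (MonoidHom.id G) (φ * MulAut.conj c).toMonoidHom)
    (FinBiset.ofHoms (MonoidHom.id G) φ.toMonoidHom) := by
  refine ⟨(Equiv.mulRight (φ c) : G ≃ G), fun g (x : G) => ?_, fun h (x : G) => ?_⟩
  · exact mul_assoc g x (φ c)
  · change x * φ (c * h * c⁻¹) * φ c = x * φ c * φ h
    simp [mul_assoc]

theorem opp_ofHoms_aut [Finite G] (φ : MulAut G) : FinBiset.Isomorphic
    (FinBiset.opp (FinBiset.ofHoms (MonoidHom.id G) φ.toMonoidHom))
    (FinBiset.ofHoms (MonoidHom.id G) (φ⁻¹ : MulAut G).toMonoidHom) := by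
  refine (FinBiset.opp_ofHoms _ _).trans ⟨(φ⁻¹ : MulAut G).toEquiv,
    fun g (x : G) => ?_, fun h (x : G) => ?_⟩
  · change φ⁻¹ (φ g * x) = g * φ⁻¹ x
    rw [map_mul, MulAut.inv_apply_self]
  · exact map_mul (φ⁻¹ : MulAut G) x h

theorem mk_graph [Finite G] (φ : MulAut G) : B.mk (FinBiset.ofSubgroup (graph φ)) =
    B.mk (FinBiset.ofHoms (MonoidHom.id G) φ.toMonoidHom) :=
  B.mk_eq (ofSubgroup_graph φ)

/-- The multiplicative map `Aut(G) → B(G, G)`, `φ ↦ [G × G / Δ_φ(G)]`. -/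
def etaAut (G : Type u) [Group G] [Finite G] : MulAut G →* B G G where
  toFun φ := B.mk (FinBiset.ofSubgroup (graph φ))
  map_one' := by rw [mk_graph]; rfl
  map_mul' φ ψ := by
    rw [mk_graph, mk_graph, mk_graph, B.mul_def, B.comp_mk, B.mk_eq (ofHoms_tensor φ ψ)]

/-- The multiplicative map `Out(G) → B(G, G)` sending the class of `φ` to `[G × G / Δ_φ(G)]`. -/
def etaOut (G : Type u) [Group G] [Finite G] : Out G →* B G G where
  toFun := Quotient.lift (s := QuotientGroup.leftRel _) (etaAut G) (by
    intro φ ψ h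
    obtain ⟨c, hc⟩ := QuotientGroup.leftRel_apply.1 h
    obtain rfl : ψ = φ * MulAut.conj c := by rw [hc]; group
    change B.mk _ = B.mk _
    rw [mk_graph, mk_graph, B.mk_eq (ofHoms_conj φ c)])
  map_one' := map_one (etaAut G)
  map_mul' := by
    rintro ⟨φ⟩ ⟨ψ⟩
    exact map_mul (etaAut G) φ ψ

/-- The ring homomorphism `η : ℤ Out(G) → B(G, G)`. -/
def eta (G : Type u) [Group G] [Finite G] : ZOut G →+* B G G :=
  (MonoidAlgebra.lift ℤ (B G G) (Out G) (etaOut G)).toRingHom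

theorem eta_of [Finite G] (φ : MulAut G) :
    eta G (MonoidAlgebra.of ℤ (Out G) (φ : Out G)) = B.mk (FinBiset.ofSubgroup (graph φ)) :=
  MonoidAlgebra.lift_of (etaOut G) (φ : Out G)

/-- The embedding of `Out(G)` in the units of `ℤ Out(G)`. -/
def outUnits (G : Type u) [Group G] : Out G →* (ZOut G)ˣ :=
  (Units.map (MonoidAlgebra.of ℤ (Out G))).comp (toUnits (G := Out G)).toMonoidHom

/-- The subgroup `⟨-1, Out(G)⟩` of the unit group of `ℤ Out(G)`. -/
def signedOut (G : Type u) [Group G] : Subgroup (ZOut G)ˣ :=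
  Subgroup.closure (insert (-1) (Set.range (outUnits G)))

theorem eta_mem [Finite G] {u : (ZOut G)ˣ} (hu : u ∈ signedOut G) :
    Units.map (eta G).toMonoidHom u ∈ B.orthogonalUnits G := by
  suffices h : signedOut G ≤ (B.orthogonalUnits G).comap (Units.map (eta G).toMonoidHom) from h hu
  refine (Subgroup.closure_le _).2 ?_
  rintro _ (rfl | ⟨⟨φ⟩, rfl⟩)
  · refine B.mem_orthogonalUnits.2 ?_
    have : ((Units.map (eta G).toMonoidHom (-1) : (B G G)ˣ) : B G G) = -1 := by
      change eta G (-1) = -1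
      rw [map_neg, map_one]
    rw [this, map_neg, B.dual_one]
    simp
  · refine B.mem_orthogonalUnits.2 ?_
    have e : ((Units.map (eta G).toMonoidHom (outUnits G (φ : Out G)) : (B G G)ˣ) : B G G)
        = etaAut G φ := eta_of φ
    have d : B.dual (etaAut G φ) = etaAut G φ⁻¹ := by
      change B.dual (B.mk _) = B.mk _
      rw [mk_graph, mk_graph, B.dual_mk, B.mk_eq (opp_ofHoms_aut φ)]
    change _ * B.dual ((Units.map (eta G).toMonoidHom (outUnits G (φ : Out G)) : (B G G)ˣ) : B G G)
      = 1 ∧ B.dual ((Units.map (eta G).toMonoidHom (outUnits G (φ : Out G)) : (B G G)ˣ) : B G G) *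
        ((Units.map (eta G).toMonoidHom (outUnits G (φ : Out G)) : (B G G)ˣ) : B G G) = 1
    rw [e, d, ← map_mul, inv_mul_cancel, map_one]
    refine ⟨?_, rfl⟩
    change ((Units.map (eta G).toMonoidHom (outUnits G (φ : Out G)) : (B G G)ˣ) : B G G) * _ = 1
    rw [e, ← map_mul, mul_inv_cancel, map_one]

/-- The restriction `η : ⟨-1, Out(G)⟩ → B_∘(G, G)`. -/
def etaOrthogonal (G : Type u) [Group G] [Finite G] : signedOut G →* B.orthogonalUnits G :=
  ((Units.map (eta G).toMonoidHom).comp (signedOut G).subtype).codRestrict (B.orthogonalUnits G)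
    fun u => eta_mem u.2

/-! The retraction `ρ`. -/

/-- The orbits of a biset: `x` and `y` are equivalent if `y = g · x · h` for some `g`, `h`. -/
def orbitSetoid {H : Type u} [Group H] (X : FinBiset G H) : Setoid X where
  r x y := ∃ (g : G) (h : H), y = g • op h • x
  iseqv :=
    { refl := fun x => ⟨1, 1, by simp⟩
      symm := by
        rintro x y ⟨g, h, rfl⟩
        refine ⟨g⁻¹, h⁻¹, ?_⟩
        rw [← smul_comm g (op h⁻¹), ← mul_smul g⁻¹ g, ← mul_smul (op h⁻¹) (op h)]
        simp
      trans := by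
        rintro x y z ⟨g, h, rfl⟩ ⟨g', h', rfl⟩
        refine ⟨g' * g, h * h', ?_⟩
        rw [← smul_comm g (op h'), op_mul, mul_smul, mul_smul] }

/-- The point `x` of the `(G, G)`-biset `X` has stabilizer `Δ_φ(G)` in `G × G`, which acts by
`(g, h) · x = g x h⁻¹`. -/
def HasGraphStabilizer (X : FinBiset G G) (x : X) (φ : MulAut G) : Prop :=
  ∀ a : G × G, a.1 • op a.2⁻¹ • x = x ↔ a ∈ graph φ

/-- The orbits of `X` isomorphic to `G × G / Δ_φ(G)` for some `φ` in the class `ω`. -/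
def graphOrbits (X : FinBiset G G) (ω : Out G) : Set (Quotient (orbitSetoid X)) :=
  {o | ∃ (x : X) (φ : MulAut G), Quotient.mk (orbitSetoid X) x = o ∧ (φ : Out G) = ω ∧
    HasGraphStabilizer X x φ}

/-- The number of orbits of `X` isomorphic to `G × G / Δ_φ(G)`, where `ω` is the class of `φ`. -/
def orbitCount (X : FinBiset G G) (ω : Out G) : ℕ := (graphOrbits X ω).ncard

theorem finite_orbits (X : FinBiset G G) (s : Set (Quotient (orbitSetoid X))) : s.Finite :=
  Set.toFinite s

/-- The map on orbits induced by a biset map. -/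
def orbitMap {X Y : FinBiset G G} (f : X → Y) (hf : FinBiset.IsBisetMap X Y f) :
    Quotient (orbitSetoid X) → Quotient (orbitSetoid Y) :=
  Quotient.map (sa := orbitSetoid X) (sb := orbitSetoid Y) f (by
    rintro x _ ⟨g, h, rfl⟩
    exact ⟨g, h, by rw [hf.1, hf.2]⟩)

theorem orbitMap_injective {X Y : FinBiset G G} (f : X → Y) (hf : FinBiset.IsBisetMap X Y f)
    (hi : Function.Injective f) : Function.Injective (orbitMap f hf) := by
  rintro ⟨x⟩ ⟨y⟩ h
  obtain ⟨a, b, e⟩ := Quotient.exact (s := orbitSetoid Y) h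
  refine Quotient.sound (s := orbitSetoid X) ⟨a, b, hi ?_⟩
  rw [hf.1, hf.2, e]

theorem HasGraphStabilizer.map_iff {X Y : FinBiset G G} (f : X → Y)
    (hf : FinBiset.IsBisetMap X Y f) (hi : Function.Injective f) (x : X) (φ : MulAut G) :
    HasGraphStabilizer Y (f x) φ ↔ HasGraphStabilizer X x φ := by
  refine forall_congr' fun a => ?_
  rw [← hf.2, ← hf.1, hi.eq_iff]

theorem orbitCount_congr {X Y : FinBiset G G} (h : FinBiset.Isomorphic X Y) (ω : Out G) :
    orbitCount X ω = orbitCount Y ω := by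
  obtain ⟨e, he⟩ := h
  have : graphOrbits Y ω = orbitMap e he '' graphOrbits X ω := by
    ext o
    constructor
    · rintro ⟨y, φ, rfl, hω, hs⟩
      refine ⟨_, ⟨e.symm y, φ, rfl, hω, ?_⟩, ?_⟩
      · rw [← HasGraphStabilizer.map_iff e he e.injective, e.apply_symm_apply]
        exact hs
      · exact congrArg (Quotient.mk (orbitSetoid Y)) (e.apply_symm_apply y)
    · rintro ⟨_, ⟨x, φ, rfl, hω, hs⟩, rfl⟩
      exact ⟨e x, φ, rfl, hω, (HasGraphStabilizer.map_iff e he e.injective x φ).2 hs⟩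
  rw [orbitCount, orbitCount, this,
    Set.ncard_image_of_injective _ (orbitMap_injective _ he e.injective)]

theorem orbitCount_empty (ω : Out G) : orbitCount (FinBiset.empty G G) ω = 0 := by
  rw [orbitCount, Set.ncard_eq_zero (finite_orbits _ _)]
  ext o
  constructor
  · rintro ⟨x, -⟩
    exact x.elim
  · rintro ⟨⟩

theorem orbitCount_sum (X Y : FinBiset G G) (ω : Out G) :
    orbitCount (FinBiset.sum X Y) ω = orbitCount X ω + orbitCount Y ω := by
  let l : X → FinBiset.sum X Y := Sum.inl
  let r : Y → FinBiset.sum X Y := Sum.inr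
  have hl : FinBiset.IsBisetMap X (FinBiset.sum X Y) l := ⟨fun _ _ => rfl, fun _ _ => rfl⟩
  have hr : FinBiset.IsBisetMap Y (FinBiset.sum X Y) r := ⟨fun _ _ => rfl, fun _ _ => rfl⟩
  have il : Function.Injective l := Sum.inl_injective
  have ir : Function.Injective r := Sum.inr_injective
  have : graphOrbits (FinBiset.sum X Y) ω =
      orbitMap l hl '' graphOrbits X ω ∪ orbitMap r hr '' graphOrbits Y ω := by
    ext o
    constructor
    · rintro ⟨x | y, φ, rfl, hω, hs⟩
      · exact Or.inl ⟨_, ⟨x, φ, rfl, hω, (HasGraphStabilizer.map_iff l hl il x φ).1 hs⟩, rfl⟩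
      · exact Or.inr ⟨_, ⟨y, φ, rfl, hω, (HasGraphStabilizer.map_iff r hr ir y φ).1 hs⟩, rfl⟩
    · rintro (⟨_, ⟨x, φ, rfl, hω, hs⟩, rfl⟩ | ⟨_, ⟨x, φ, rfl, hω, hs⟩, rfl⟩)
      · exact ⟨l x, φ, rfl, hω, (HasGraphStabilizer.map_iff l hl il x φ).2 hs⟩
      · exact ⟨r x, φ, rfl, hω, (HasGraphStabilizer.map_iff r hr ir x φ).2 hs⟩
  have disj : Disjoint (orbitMap l hl '' graphOrbits X ω)
      (orbitMap r hr '' graphOrbits Y ω) := by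
    rw [Set.disjoint_left]
    rintro _ ⟨⟨x⟩, -, rfl⟩ ⟨⟨y⟩, -, h⟩
    obtain ⟨a, b, e⟩ := Quotient.exact (s := orbitSetoid (FinBiset.sum X Y)) h
    exact Sum.inl_ne_inr e
  rw [orbitCount, this, Set.ncard_union_eq disj (finite_orbits _ _) (finite_orbits _ _),
    Set.ncard_image_of_injective _ (orbitMap_injective l hl il),
    Set.ncard_image_of_injective _ (orbitMap_injective r hr ir)]
  rfl

/-- The map `ρ : B(G, G) → ℤ Out(G)`. It is the additive map that sends the class of a transitive
biset to the class of `φ` if the biset is isomorphic to `G × G / Δ_φ(G)` for an automorphism `φ`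
of `G`, and to `0` if it is not of this form; hence it sends the class of a biset `X` to the sum of
all `ω` in `Out(G)`, each taken as often as it arises in this way from an orbit of `X`. -/
def rho (G : Type u) [Group G] [Finite G] : B G G →+ ZOut G :=
  B.lift
    { toFun := fun c => ∑ᶠ ω : Out G, MonoidAlgebra.single ω
        (Quotient.lift (s := FinBiset.setoid G G) (fun X => (orbitCount X ω : ℤ))
          (fun _ _ h => by rw [orbitCount_congr h]) c)
      map_zero' := by
        refine (finsum_congr fun ω => ?_).trans finsum_zero
        change MonoidAlgebra.single ω ((orbitCount (FinBiset.empty G G) ω : ℕ) : ℤ) = 0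
        simp [orbitCount_empty]
      map_add' := by
        rintro ⟨X⟩ ⟨Y⟩
        refine Eq.trans (finsum_congr fun ω => ?_)
          (finsum_add_distrib (Set.toFinite _) (Set.toFinite _))
        change MonoidAlgebra.single ω ((orbitCount (FinBiset.sum X Y) ω : ℕ) : ℤ) =
          MonoidAlgebra.single ω ((orbitCount X ω : ℕ) : ℤ) +
            MonoidAlgebra.single ω ((orbitCount Y ω : ℕ) : ℤ)
        rw [orbitCount_sum, Nat.cast_add, MonoidAlgebra.single_add] }

theorem rho_mk [Finite G] (X : FinBiset G G) :
    rho G (B.mk X) = ∑ᶠ ω : Out G, MonoidAlgebra.single ω (orbitCount X ω : ℤ) :=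
  B.lift_ofClass _ _

end

/-- The group `Γ` is the internal direct product of its subgroups `S` and `T`: both are normal,
they intersect trivially, and together they generate `Γ`. -/
structure IsInternalDirectProduct {Γ : Type*} [Group Γ] (S T : Subgroup Γ) : Prop where
  normal_left : S.Normal
  normal_right : T.Normal
  inf_eq_bot : S ⊓ T = ⊥
  sup_eq_top : S ⊔ T = ⊤

end DoubleBurnside

/-! Since `G × G` is abelian, all points of `G × G / L` have stabilizer `L`, so an element `a` of
`B(G, G)` is determined by the numbers `weight L a`, which are `|G| / |L|` times its coefficients.
In these terms composition becomes composition of relations with the factor `overlap`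
(`weight_mul`), duality becomes `converse`, and the identity is the diagonal `graph 1`. For an
orthogonal unit `u`, the equation `u° u = 1` turns into a family of quadratic identities, one for
each test function on relations (`sum_orthogonality`).

The subgroups of `G` form a chain. Testing agreement with the diagonal on `H × H`, for `H ≠ 1`,
therefore yields a sum of squares equal to `1` (`sum_sliceWeight_sq`). For `H = G` it shows that
exactly one automorphism occurs in `u`, with coefficient `±1`; multiplying by an element of `im(η)`
makes it the identity with coefficient `1`. For smaller `H` the slice weight of the diagonal is `1`
modulo `p` and has square at most `1`, so it equals `1` because `p` is odd, and every other slice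
weight vanishes. Descending induction on the second projection then shows that `u` and `1` have the
same weights on all relations with trivial right kernel and nontrivial second projection.

The relations `K × 1` remain. Write `c_K` for their weights and `d(g)` for the sum of `c_K` over all
`K` containing `g`. One more test function gives `2 c_1 + ∑ d(g)² = 0`, which confines `c_1` to
`[-4, 0]`. As `c_1` is a multiple of `|G| ≥ 9`, it is zero; hence all `d(g)`, and then all `c_K`,
vanish. This is where `n > 1` is needed.

Applied to `u` and to `u°`, this shows that `u - 1` involves only relations with both kernels
nontrivial, hence containing `C_p`. On these `Inf ∘ Def` acts as an identity from both sides, so `u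
- 1` is inflated from `G / C_p` and `u` lies in the image of `dBInf`. Conversely, nothing of the
form `Inf ∘ Def ∘ a` involves an automorphism, so the image of `dBInf` lies in the kernel of `ρ` and
meets `im(η)` trivially. Finally `im(η)` is central, automorphisms of a cyclic group being power
maps. -/

namespace DoubleBurnside

noncomputable section

open scoped Classical

variable {G : Type u} [CommGroup G]

/-! ### Stabilizers in bisets over an abelian group -/

namespace FinBiset

/-- A `(G, G)`-biset as a `G × G`-set, with `(g, h) · x = g x h⁻¹`. -/
instance prodAction (X : FinBiset G G) : MulAction (G × G) X where
  smul a x := a.1 • op a.2⁻¹ • x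
  one_smul x := by
    change (1 : G) • op (1 : G)⁻¹ • x = x
    simp
  mul_smul a b x := by
    change (a.1 * b.1) • op (a.2 * b.2)⁻¹ • x = a.1 • op a.2⁻¹ • b.1 • op b.2⁻¹ • x
    rw [X.comm, ← mul_smul a.1, ← mul_smul (op a.2⁻¹), ← op_mul, ← mul_inv_rev]

theorem prod_smul_def (X : FinBiset G G) (a : G × G) (x : X) :
    a • x = a.1 • op a.2⁻¹ • x := rfl

theorem left_smul_eq (X : FinBiset G G) (g : G) (x : X) : g • x = ((g, 1) : G × G) • x := by
  simp [prod_smul_def]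

theorem right_smul_eq (X : FinBiset G G) (h : G) (x : X) :
    op h • x = ((1, h⁻¹) : G × G) • x := by
  simp [prod_smul_def]

theorem isBisetMap_of_prod {X Y : FinBiset G G} {f : X → Y}
    (hf : ∀ (a : G × G) (x : X), f (a • x) = a • f x) : IsBisetMap X Y f :=
  ⟨fun g x => by rw [left_smul_eq, hf, ← left_smul_eq],
    fun h x => by rw [right_smul_eq, hf, ← right_smul_eq]⟩

theorem IsBisetMap.map_prod_smul {X Y : FinBiset G G} {f : X → Y} (hf : IsBisetMap X Y f)
    (a : G × G) (x : X) : f (a • x) = a • f x := by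
  rw [prod_smul_def, hf.1, hf.2, ← prod_smul_def]

/-- The stabilizer in `G × G` of a point of a biset. -/
def stab (X : FinBiset G G) (x : X) : Subgroup (G × G) := MulAction.stabilizer (G × G) x

theorem mem_stab {X : FinBiset G G} {x : X} {a : G × G} :
    a ∈ X.stab x ↔ a.1 • op a.2⁻¹ • x = x := Iff.rfl

theorem mem_stab_iff_smul {X : FinBiset G G} {x : X} {a : G × G} :
    a ∈ X.stab x ↔ a • x = x := Iff.rfl

theorem IsBisetMap.stab_eq {X Y : FinBiset G G} {f : X → Y} (hf : IsBisetMap X Y f)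
    (hi : Function.Injective f) (x : X) : Y.stab (f x) = X.stab x := by
  ext a
  rw [mem_stab_iff_smul, mem_stab_iff_smul, ← hf.map_prod_smul, hi.eq_iff]

/-- The number of points with stabilizer `L`. -/
def pointCount (X : FinBiset G G) (L : Subgroup (G × G)) : ℕ := Nat.card {x : X // X.stab x = L}

theorem pointCount_congr {X Y : FinBiset G G} (h : Isomorphic X Y) (L : Subgroup (G × G)) :
    X.pointCount L = Y.pointCount L := by
  obtain ⟨e, he⟩ := h
  exact Nat.card_congr (e.subtypeEquiv fun x => by
    rw [IsBisetMap.stab_eq he e.injective])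

theorem pointCount_empty (L : Subgroup (G × G)) : (empty G G).pointCount L = 0 := by
  have : IsEmpty (empty G G) := inferInstanceAs (IsEmpty PEmpty)
  exact Nat.card_of_isEmpty

theorem pointCount_sum (X Y : FinBiset G G) (L : Subgroup (G × G)) :
    (sum X Y).pointCount L = X.pointCount L + Y.pointCount L := by
  have hl : ∀ x : X, (sum X Y).stab (Sum.inl x) = X.stab x :=
    IsBisetMap.stab_eq (X := X) (Y := sum X Y) ⟨fun _ _ => rfl, fun _ _ => rfl⟩ Sum.inl_injective
  have hr : ∀ x : Y, (sum X Y).stab (Sum.inr x) = Y.stab x :=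
    IsBisetMap.stab_eq (X := Y) (Y := sum X Y) ⟨fun _ _ => rfl, fun _ _ => rfl⟩ Sum.inr_injective
  have e : {z : sum X Y // (sum X Y).stab z = L} ≃
      {x : X // X.stab x = L} ⊕ {y : Y // Y.stab y = L} :=
    (Equiv.subtypeSum (p := fun z : X ⊕ Y => (sum X Y).stab z = L)).trans
      (Equiv.sumCongr (Equiv.subtypeEquivRight fun x => by rw [hl])
        (Equiv.subtypeEquivRight fun x => by rw [hr]))
  rw [pointCount, Nat.card_congr e, Nat.card_sum]
  rfl

theorem opp_stab (X : FinBiset G G) (x : X) :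
    (opp X).stab x = (X.stab x).comap (MulEquiv.prodComm (M := G) (N := G)).toMonoidHom := by
  ext a
  change op (a.1)⁻¹ • ((a.2)⁻¹)⁻¹ • (x : X) = x ↔ a.2 • op (a.1)⁻¹ • (x : X) = x
  rw [inv_inv, X.comm]

/-! ### Decomposition into transitive bisets -/

/-- The biset structure on an invariant subset. -/
def restrict (X : FinBiset G G) (s : Set X) (hs : ∀ (a : G × G), ∀ x ∈ s, a • x ∈ s) :
    FinBiset G G where
  carrier := s
  left :=
    { smul := fun g x => ⟨g • x.1, by rw [left_smul_eq]; exact hs _ _ x.2⟩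
      one_smul := fun x => Subtype.ext (one_smul G x.1)
      mul_smul := fun g h x => Subtype.ext (mul_smul g h x.1) }
  right :=
    { smul := fun g x => ⟨g • x.1, by
        have := hs (1, (unop g)⁻¹) x.1 x.2
        rwa [← right_smul_eq] at this⟩
      one_smul := fun x => Subtype.ext (one_smul Gᵐᵒᵖ x.1)
      mul_smul := fun g h x => Subtype.ext (mul_smul g h x.1) }
  comm := fun g h x => Subtype.ext (X.comm g h x.1)

theorem isomorphic_sum_restrict (X : FinBiset G G) (s : Set X)
    (hs : ∀ (a : G × G), ∀ x ∈ s, a • x ∈ s) (ht : ∀ (a : G × G), ∀ x ∈ sᶜ, a • x ∈ sᶜ) :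
    Isomorphic (sum (X.restrict s hs) (X.restrict sᶜ ht)) X := by
  refine ⟨Equiv.Set.sumCompl s, ?_, ?_⟩
  · rintro g (x | x) <;> rfl
  · rintro g (x | x) <;> rfl

variable [Finite G]

theorem ofSubgroup_prod_smul (L : Subgroup (G × G)) (a b : G × G) :
    (a • (show ofSubgroup L from (QuotientGroup.mk b : (G × G) ⧸ L)) : ofSubgroup L) =
      (QuotientGroup.mk (a * b) : (G × G) ⧸ L) := by
  refine congrArg (QuotientGroup.mk (s := L)) ?_
  refine Prod.ext ?_ ?_
  · change a.1 * (1 * b.1) = a.1 * b.1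
    rw [one_mul]
  · change 1 * ((a.2⁻¹)⁻¹ * b.2) = a.2 * b.2
    rw [one_mul, inv_inv]

/-- Stabilizers along an orbit are conjugate, hence equal in the abelian group `G × G`. This is why
counting points by their exact stabilizer can replace marks. -/
theorem ofSubgroup_stab (L : Subgroup (G × G)) (x : ofSubgroup L) : (ofSubgroup L).stab x = L := by
  obtain ⟨b, rfl⟩ := QuotientGroup.mk_surjective (s := L) x
  ext a
  refine mem_stab_iff_smul.trans ?_
  refine (Eq.congr_left (ofSubgroup_prod_smul L a b)).trans ?_
  refine (QuotientGroup.eq (s := L)).trans ?_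
  have : (a * b)⁻¹ * b = a⁻¹ := by rw [mul_inv]; exact inv_mul_cancel_right _ _
  rw [this, inv_mem_iff]

theorem isomorphic_ofSubgroup (X : FinBiset G G) (x : X) (hx : ∀ y : X, ∃ a : G × G, y = a • x) :
    Isomorphic (ofSubgroup (X.stab x)) X := by
  let e : ofSubgroup (X.stab x) → X := MulAction.ofQuotientStabilizer (G × G) x
  refine Isomorphic.of_bijective e ⟨MulAction.injective_ofQuotientStabilizer (G × G) x, ?_⟩ ?_
  · intro y
    obtain ⟨a, rfl⟩ := hx y
    exact ⟨(QuotientGroup.mk a : (G × G) ⧸ X.stab x), rfl⟩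
  · refine isBisetMap_of_prod fun a q => ?_
    obtain ⟨b, rfl⟩ := QuotientGroup.mk_surjective (s := X.stab x) q
    rw [show a • (show ofSubgroup (X.stab x) from (QuotientGroup.mk b : (G × G) ⧸ X.stab x)) =
      (QuotientGroup.mk (a * b) : (G × G) ⧸ X.stab x) from ofSubgroup_prod_smul _ a b]
    exact mul_smul a b x

end FinBiset

open FinBiset

variable [Finite G]

theorem B.mk_empty : B.mk (FinBiset.empty G G) = 0 := map_zero B.ofClass

theorem B.mk_sum (X Y : FinBiset G G) : B.mk (FinBiset.sum X Y) = B.mk X + B.mk Y :=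
  map_add B.ofClass (show BisetClass G G from Quotient.mk _ X)
    (show BisetClass G G from Quotient.mk _ Y)

/-- The class of the transitive biset `G × G / L`. -/
def B.basis (L : Subgroup (G × G)) : B G G := B.mk (ofSubgroup L)

/-- Induction on the number of points: split off one orbit, which is transitive, and apply the
hypothesis to its complement. -/
theorem B.mk_mem_closure (X : FinBiset G G) :
    B.mk X ∈ AddSubgroup.closure (Set.range (B.basis (G := G))) := by
  induction hn : Nat.card X using Nat.strong_induction_on generalizing X with
  | _ n ih =>
    subst hn
    rcases isEmpty_or_nonempty X with h | ⟨⟨x⟩⟩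
    · have : IsEmpty (FinBiset.empty G G) := inferInstanceAs (IsEmpty PEmpty)
      have e : Isomorphic X (FinBiset.empty G G) :=
        ⟨Equiv.equivOfIsEmpty _ _, fun _ x => isEmptyElim x, fun _ x => isEmptyElim x⟩
      rw [B.mk_eq e, B.mk_empty]
      exact zero_mem _
    · let s : Set X := MulAction.orbit (G × G) x
      have hs : ∀ (a : G × G), ∀ y ∈ s, a • y ∈ s := fun a y hy =>
        by
        obtain ⟨b, rfl⟩ := hy
        exact ⟨a * b, mul_smul a b x⟩
      have ht : ∀ (a : G × G), ∀ y ∈ sᶜ, a • y ∈ sᶜ := fun a y hy h =>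
        by
        obtain ⟨b, hb⟩ := h
        exact hy ⟨a⁻¹ * b, (mul_smul a⁻¹ b x).trans (by rw [show b • x = a • y from hb, inv_smul_smul])⟩
      rw [← B.mk_eq (isomorphic_sum_restrict X s hs ht), B.mk_sum]
      refine add_mem ?_ (ih _ ?_ _ rfl)
      · have := isomorphic_ofSubgroup (X.restrict s hs)
          ⟨x, MulAction.mem_orbit_self x⟩ (by
            rintro ⟨y, a, rfl⟩
            exact ⟨a, rfl⟩)
        rw [← B.mk_eq this]
        exact AddSubgroup.subset_closure ⟨_, rfl⟩
      · refine Finite.card_subtype_lt (p := (· ∈ sᶜ)) (x := x) ?_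
        exact fun h => h (MulAction.mem_orbit_self x)

theorem B.closure_basis : AddSubgroup.closure (Set.range (B.basis (G := G))) = ⊤ := by
  set S := AddSubgroup.closure (Set.range (B.basis (G := G)))
  -- The projection modulo the span kills every class `[X]`, hence is zero by the universal property
  -- of the Grothendieck group.
  have h : QuotientAddGroup.mk' S = 0 := B.hom_ext fun X =>
    (QuotientAddGroup.eq_zero_iff _).2 (B.mk_mem_closure X)
  refine eq_top_iff.2 fun a _ => (QuotientAddGroup.eq_zero_iff a).1 ?_
  exact DFunLike.congr_fun h a

theorem B.hom_ext_basis {A : Type*} [AddCommGroup A] {f g : B G G →+ A}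
    (h : ∀ L, f (B.basis L) = g (B.basis L)) : f = g := by
  refine AddMonoidHom.eq_of_eqOn_dense B.closure_basis ?_
  rintro _ ⟨L, rfl⟩
  exact h L

/-! ### Weights: normalized coefficients -/

/-- The additive function on `B(G, G)` that counts the points with stabilizer `L`, divided by
the order of `G`. -/
def weight (L : Subgroup (G × G)) : B G G →+ ℚ :=
  B.lift
    { toFun := fun c => Quotient.lift (s := FinBiset.setoid G G)
        (fun X => (X.pointCount L : ℚ) / Nat.card G)
        (fun _ _ h => by rw [pointCount_congr h]) c
      map_zero' := by
        change (((FinBiset.empty G G).pointCount L : ℕ) : ℚ) / Nat.card G = 0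
        simp [pointCount_empty]
      map_add' := by
        rintro ⟨X⟩ ⟨Y⟩
        change (((FinBiset.sum X Y).pointCount L : ℕ) : ℚ) / Nat.card G =
          ((X.pointCount L : ℕ) : ℚ) / Nat.card G + ((Y.pointCount L : ℕ) : ℚ) / Nat.card G
        rw [pointCount_sum, Nat.cast_add, add_div] }

theorem weight_mk (L : Subgroup (G × G)) (X : FinBiset G G) :
    weight L (B.mk X) = (X.pointCount L : ℚ) / Nat.card G :=
  B.lift_ofClass _ _

theorem weight_basis (L M : Subgroup (G × G)) :
    weight L (B.basis M) = if M = L then (Nat.card G : ℚ) / Nat.card L else 0 := by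
  have hG : (Nat.card G : ℚ) ≠ 0 := Nat.cast_ne_zero.2 Nat.card_pos.ne'
  rw [B.basis, weight_mk]
  split_ifs with h
  · subst h
    have e : (ofSubgroup M).pointCount M = Nat.card ((G × G) ⧸ M) :=
      Nat.card_congr (Equiv.subtypeUnivEquiv (ofSubgroup_stab M))
    have hM : (Nat.card M : ℚ) ≠ 0 := Nat.cast_ne_zero.2 Nat.card_pos.ne'
    have hc := Subgroup.card_eq_card_quotient_mul_card_subgroup M
    rw [Nat.card_prod] at hc
    rw [e, div_eq_div_iff hG hM]
    exact_mod_cast hc.symm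
  · have : IsEmpty {x : ofSubgroup M // (ofSubgroup M).stab x = L} :=
      ⟨fun x => h ((ofSubgroup_stab M x.1).symm.trans x.2)⟩
    rw [pointCount, Nat.card_of_isEmpty]
    simp

instance {H : Type*} [Group H] [Finite H] : Fintype (Subgroup H) := Fintype.ofFinite _

/-- Integrality enters through this form: a weight is an integer multiple of `|G| / |L|`, which
gives the later divisibility by `p` and by `|G|`. -/
theorem B.exists_eq_sum_basis (a : B G G) :
    ∃ c : Subgroup (G × G) → ℤ, a = ∑ L, c L • B.basis L ∧
      ∀ L, weight L a = c L * ((Nat.card G : ℚ) / Nat.card L) := by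
  have h : a ∈ AddSubgroup.closure (Set.range (B.basis (G := G))) := by
    rw [B.closure_basis]; trivial
  have h' : ∃ c : Subgroup (G × G) → ℤ, a = ∑ L, c L • B.basis L := by
    induction h using AddSubgroup.closure_induction with
    | mem x hx =>
      obtain ⟨L, rfl⟩ := hx
      exact ⟨Pi.single L 1, by simp [Pi.single_apply, ite_smul]⟩
    | zero => exact ⟨0, by simp⟩
    | add x y _ _ hx hy =>
      obtain ⟨c, rfl⟩ := hx
      obtain ⟨d, rfl⟩ := hy
      exact ⟨c + d, by simp [add_smul, Finset.sum_add_distrib]⟩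
    | neg x _ hx =>
      obtain ⟨c, rfl⟩ := hx
      exact ⟨-c, by simp⟩
  obtain ⟨c, rfl⟩ := h'
  refine ⟨c, rfl, fun L => ?_⟩
  simp only [map_sum, map_zsmul, weight_basis]
  simp

theorem weight_ext {a b : B G G} (h : ∀ L, weight L a = weight L b) : a = b := by
  obtain ⟨c, hc, hcw⟩ := B.exists_eq_sum_basis (a - b)
  have : ∀ L, c L = 0 := fun L => by
    have h1 := hcw L
    rw [map_sub, h, sub_self] at h1
    have hG : (Nat.card G : ℚ) ≠ 0 := Nat.cast_ne_zero.2 Nat.card_pos.ne'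
    have hL : (Nat.card L : ℚ) ≠ 0 := Nat.cast_ne_zero.2 Nat.card_pos.ne'
    exact_mod_cast (mul_eq_zero.1 h1.symm).resolve_right (div_ne_zero hG hL)
  rw [← sub_eq_zero, hc]
  simp [this]

end

noncomputable section

open scoped Classical

/-! ### Subgroups of `G × G` as relations -/

section Relations

variable {G : Type u} [Group G]

/-- The subgroup `{x | (x, 1) ∈ L}`. -/
def leftKer (L : Subgroup (G × G)) : Subgroup G := L.comap (MonoidHom.inl G G)

/-- The subgroup `{y | (1, y) ∈ L}`. -/
def rightKer (L : Subgroup (G × G)) : Subgroup G := L.comap (MonoidHom.inr G G)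

/-- The converse relation. -/
def converse (L : Subgroup (G × G)) : Subgroup (G × G) :=
  L.comap (MulEquiv.prodComm (M := G) (N := G)).toMonoidHom

/-- The composite relation. -/
def relComp (L M : Subgroup (G × G)) : Subgroup (G × G) where
  carrier := {a | ∃ y, (a.1, y) ∈ L ∧ (y, a.2) ∈ M}
  one_mem' := ⟨1, one_mem L, one_mem M⟩
  mul_mem' := by
    rintro a b ⟨y, h1, h2⟩ ⟨z, k1, k2⟩
    exact ⟨y * z, mul_mem h1 k1, mul_mem h2 k2⟩
  inv_mem' := by
    rintro a ⟨y, h1, h2⟩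
    exact ⟨y⁻¹, inv_mem h1, inv_mem h2⟩

/-- The number of elements `y` with `(1, y) ∈ L` and `(y, 1) ∈ M`. -/
def overlap (L M : Subgroup (G × G)) : ℕ := Nat.card (rightKer L ⊓ leftKer M : Subgroup G)

theorem mem_leftKer {L : Subgroup (G × G)} {x : G} : x ∈ leftKer L ↔ (x, 1) ∈ L := Iff.rfl

theorem mem_rightKer {L : Subgroup (G × G)} {x : G} : x ∈ rightKer L ↔ (1, x) ∈ L := Iff.rfl

theorem mem_converse {L : Subgroup (G × G)} {a : G × G} : a ∈ converse L ↔ (a.2, a.1) ∈ L :=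
  Iff.rfl

theorem mem_relComp {L M : Subgroup (G × G)} {a : G × G} :
    a ∈ relComp L M ↔ ∃ y, (a.1, y) ∈ L ∧ (y, a.2) ∈ M := Iff.rfl

theorem converse_converse (L : Subgroup (G × G)) : converse (converse L) = L := rfl

theorem converse_injective : Function.Injective (converse (G := G)) :=
  Function.LeftInverse.injective converse_converse

theorem rightKer_converse (L : Subgroup (G × G)) : rightKer (converse L) = leftKer L := rfl

end Relations

variable {G : Type u} [CommGroup G]

/-! ### Stabilizers and cardinality of tensor products -/

namespace FinBiset

theorem tensor_stab (X Y : FinBiset G G) (x : X) (y : Y) :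
    (tensor X Y).stab (Quotient.mk (tensorSetoid X Y) (x, y)) =
      relComp (X.stab x) (Y.stab y) := by
  ext a
  have h : a ∈ (tensor X Y).stab (Quotient.mk (tensorSetoid X Y) (x, y)) ↔
      (Quotient.mk (tensorSetoid X Y) (a.1 • x, op a.2⁻¹ • y)) =
        Quotient.mk (tensorSetoid X Y) (x, y) := Iff.rfl
  rw [h, Quotient.eq, mem_relComp]
  refine exists_congr fun g => ?_
  rw [mem_stab, mem_stab]
  change (x, y) = (op g⁻¹ • a.1 • x, g • op a.2⁻¹ • y) ↔ _
  rw [Prod.ext_iff, X.comm, eq_comm (a := x), eq_comm (a := y)]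

/-- The set `X × Y` on which `G` acts by `h · (x, y) = (x h⁻¹, h y)`. -/
def MiddleProd (X Y : FinBiset G G) : Type u := X × Y

instance (X Y : FinBiset G G) : MulAction G (MiddleProd X Y) where
  smul h a := (op h⁻¹ • a.1, h • a.2)
  one_smul a := by
    change (op (1 : G)⁻¹ • a.1, (1 : G) • a.2) = (a.1, a.2)
    simp
  mul_smul g h a := by
    change (op (g * h)⁻¹ • a.1, (g * h) • a.2) = (op g⁻¹ • op h⁻¹ • a.1, g • h • a.2)
    rw [mul_smul, ← mul_smul (op g⁻¹), ← op_mul, ← mul_inv_rev]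

/-- Burnside's orbit count for the middle action of `G` on `X × Y`. The elements fixing a point are
the same for all points, namely `rightKer L ⊓ leftKer M`. -/
theorem card_tensor (X Y : FinBiset G G) (L M : Subgroup (G × G)) (hX : ∀ x, X.stab x = L)
    (hY : ∀ y, Y.stab y = M) :
    Nat.card (tensor X Y) * Nat.card G = overlap L M * (Nat.card X * Nat.card Y) := by
  have e1 : (tensor X Y : Type u) ≃ MulAction.orbitRel.Quotient G (MiddleProd X Y) :=
    Quotient.congrRight (r := tensorSetoid X Y) (r' := MulAction.orbitRel G (MiddleProd X Y))
      fun a b => (Setoid.comm' (tensorSetoid X Y)).trans (exists_congr fun g => eq_comm)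
  have mem : ∀ (g : G) (a : MiddleProd X Y), g • a = a ↔ g ∈ rightKer L ⊓ leftKer M := by
    rintro g ⟨x, y⟩
    rw [Subgroup.mem_inf, mem_rightKer, mem_leftKer, ← hX x, ← hY y, mem_stab, mem_stab]
    refine (Prod.ext_iff (x := (op g⁻¹ • x, g • y)) (y := (x, y))).trans ?_
    simp
  -- An element fixing one point fixes all of them, so the set of fixed pairs is a product.
  have e2 : (Σ g : G, MulAction.fixedBy (MiddleProd X Y) g) ≃
      (rightKer L ⊓ leftKer M : Subgroup G) × (MiddleProd X Y) :=
    { toFun := fun s => (⟨s.1, (mem _ s.2.1).1 s.2.2⟩, s.2.1)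
      invFun := fun s => ⟨s.1.1, s.2, (mem _ s.2).2 s.1.2⟩
      left_inv := fun _ => rfl
      right_inv := fun _ => rfl }
  have e3 := MulAction.sigmaFixedByEquivOrbitsProdGroup G (MiddleProd X Y)
  rw [Nat.card_congr e1, ← Nat.card_prod, ← Nat.card_congr e3, Nat.card_congr e2, Nat.card_prod]
  exact congrArg _ (Nat.card_prod X Y)

end FinBiset

open FinBiset

theorem card_graph (φ : MulAut G) : Nat.card (graph φ) = Nat.card G :=
  (Nat.card_congr (MonoidHom.ofInjective (f := MonoidHom.prod φ.toMonoidHom (MonoidHom.id G))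
    fun _ _ h => congrArg Prod.snd h).toEquiv).symm

theorem mem_graph_one {a : G × G} : a ∈ graph (1 : MulAut G) ↔ a.1 = a.2 := mem_graph

theorem graph_injective : Function.Injective (graph (G := G)) := fun φ ψ h => by
  ext x
  have : (φ x, x) ∈ graph ψ := h ▸ mem_graph.2 rfl
  exact mem_graph.1 this

theorem relComp_graph_left (φ : MulAut G) (L : Subgroup (G × G)) {a : G × G} :
    a ∈ relComp (graph φ) L ↔ (φ⁻¹ a.1, a.2) ∈ L := by
  rw [mem_relComp]
  constructor
  · rintro ⟨y, h1, h2⟩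
    have h1 : a.1 = φ y := mem_graph.1 h1
    rwa [h1, MulAut.inv_apply_self]
  · intro h
    exact ⟨φ⁻¹ a.1, mem_graph.2 (MulAut.apply_inv_self _ _ _).symm, h⟩

theorem relComp_graph_right (φ : MulAut G) (L : Subgroup (G × G)) {a : G × G} :
    a ∈ relComp L (graph φ) ↔ (a.1, φ a.2) ∈ L := by
  rw [mem_relComp]
  constructor
  · rintro ⟨y, h1, h2⟩
    have h2 : y = φ a.2 := mem_graph.1 h2
    rwa [← h2]
  · intro h
    exact ⟨_, h, mem_graph.2 rfl⟩

/-! ### The composition formula in terms of weights -/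

variable [Finite G]

/-- All points of the tensor product have stabilizer `relComp L M`, so only their number matters.
The division by `|G|` in `weight` absorbs the division by `|G|` in the orbit count. -/
theorem weight_basis_mul_basis (P L M : Subgroup (G × G)) :
    weight P (B.basis L * B.basis M) = if relComp L M = P then
      (overlap L M : ℚ) * ((Nat.card G : ℚ) / Nat.card L) * ((Nat.card G : ℚ) / Nat.card M)
      else 0 := by
  have hs : ∀ z, (tensor (ofSubgroup L) (ofSubgroup M)).stab z = relComp L M := by
    rintro ⟨x, y⟩
    refine (tensor_stab (ofSubgroup L) (ofSubgroup M) x y).trans ?_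
    rw [ofSubgroup_stab, ofSubgroup_stab]
  rw [B.mul_def, B.basis, B.basis, B.comp_mk, weight_mk]
  split_ifs with h
  · have hG : (Nat.card G : ℚ) ≠ 0 := Nat.cast_ne_zero.2 Nat.card_pos.ne'
    have hL : (Nat.card L : ℚ) ≠ 0 := Nat.cast_ne_zero.2 Nat.card_pos.ne'
    have hM : (Nat.card M : ℚ) ≠ 0 := Nat.cast_ne_zero.2 Nat.card_pos.ne'
    have e : (tensor (ofSubgroup L) (ofSubgroup M)).pointCount P =
        Nat.card (tensor (ofSubgroup L) (ofSubgroup M)) :=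
      Nat.card_congr (Equiv.subtypeUnivEquiv fun z => (hs z).trans h)
    have hc := card_tensor _ _ L M (ofSubgroup_stab L) (ofSubgroup_stab M)
    have h1 := Subgroup.card_eq_card_quotient_mul_card_subgroup L
    have h2 := Subgroup.card_eq_card_quotient_mul_card_subgroup M
    rw [Nat.card_prod] at h1 h2
    change _ = overlap L M * (Nat.card ((G × G) ⧸ L) * Nat.card ((G × G) ⧸ M)) at hc
    rw [e]
    qify at hc h1 h2
    field_simp
    refine mul_right_cancel₀ hG ?_
    generalize (Nat.card (tensor (ofSubgroup L) (ofSubgroup M)) : ℚ) = t at *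
    generalize (Nat.card ((G × G) ⧸ L) : ℚ) = x at *
    generalize (Nat.card ((G × G) ⧸ M) : ℚ) = y at *
    linear_combination (Nat.card L : ℚ) * Nat.card M * hc -
      (overlap L M : ℚ) * Nat.card M * y * h1 - (overlap L M : ℚ) * Nat.card G ^ 2 * h2
  · have : IsEmpty {z // (tensor (ofSubgroup L) (ofSubgroup M)).stab z = P} :=
      ⟨fun z => h ((hs z.1).symm.trans z.2)⟩
    rw [pointCount, Nat.card_of_isEmpty]
    simp

theorem weight_mul (P : Subgroup (G × G)) (a b : B G G) :
    weight P (a * b) = ∑ L, ∑ M, if relComp L M = P then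
      (overlap L M : ℚ) * weight L a * weight M b else 0 := by
  obtain ⟨c, hc, hcw⟩ := B.exists_eq_sum_basis a
  obtain ⟨d, hd, hdw⟩ := B.exists_eq_sum_basis b
  simp_rw [hcw, hdw]
  rw [hc, hd, Finset.sum_mul_sum, map_sum]
  refine Finset.sum_congr rfl fun L _ => ?_
  rw [map_sum]
  refine Finset.sum_congr rfl fun M _ => ?_
  rw [smul_mul_smul_comm, map_zsmul, weight_basis_mul_basis]
  split_ifs
  · rw [zsmul_eq_mul]
    push_cast
    ring
  · simp

/-- The composition formula summed against a function of the stabilizer. -/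
theorem sum_mul_weight_mul (κ : Subgroup (G × G) → ℚ) (a b : B G G) :
    ∑ P, κ P * weight P (a * b) =
      ∑ L, ∑ M, κ (relComp L M) * (overlap L M * weight L a * weight M b) := by
  simp_rw [weight_mul, Finset.mul_sum]
  rw [Finset.sum_comm]
  refine Finset.sum_congr rfl fun L _ => ?_
  rw [Finset.sum_comm]
  refine Finset.sum_congr rfl fun M _ => ?_
  simp

theorem weight_dual (L : Subgroup (G × G)) (a : B G G) :
    weight L (B.dual a) = weight (converse L) a := by
  have : (weight L).comp B.dual = weight (converse L) := B.hom_ext fun X => by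
    rw [AddMonoidHom.comp_apply, B.dual_mk, weight_mk, weight_mk]
    congr 2
    refine Nat.card_congr (Equiv.subtypeEquivRight fun x => ?_)
    refine (Eq.congr_left (opp_stab X x)).trans ?_
    change converse (X.stab x) = L ↔ X.stab x = converse L
    rw [← converse_injective.eq_iff, converse_converse]
  exact DFunLike.congr_fun this a

theorem weight_mk_graph (L : Subgroup (G × G)) (φ : MulAut G) :
    weight L (B.mk (ofSubgroup (graph φ))) = if graph φ = L then 1 else 0 := by
  change weight L (B.basis (graph φ)) = _
  rw [weight_basis]
  refine if_ctx_congr Iff.rfl (fun h => ?_) fun _ => rfl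
  rw [← h, card_graph, div_self (Nat.cast_ne_zero.2 Nat.card_pos.ne')]

theorem mk_graph_one : B.mk (ofSubgroup (graph (1 : MulAut G))) = 1 := map_one (etaAut G)

theorem weight_one (L : Subgroup (G × G)) :
    weight L (1 : B G G) = if graph 1 = L then 1 else 0 := by
  rw [← mk_graph_one, weight_mk_graph]

/-- A graph is an invertible relation with trivial kernels, so multiplying by it only permutes the
weights; this serves to normalize a unit. -/
theorem weight_graph_mul (φ : MulAut G) (P : Subgroup (G × G)) (a : B G G) :
    weight P (B.mk (ofSubgroup (graph φ)) * a) = weight (relComp (graph φ⁻¹) P) a := by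
  rw [weight_mul, Finset.sum_eq_single (graph φ)]
  · rw [Finset.sum_eq_single (relComp (graph φ⁻¹) P)]
    · have h1 : relComp (graph φ) (relComp (graph φ⁻¹) P) = P := by
        ext a
        simp [relComp_graph_left]
      have h2 : overlap (graph φ) (relComp (graph φ⁻¹) P) = 1 := by
        have : rightKer (graph φ) = ⊥ := by
          refine (Subgroup.eq_bot_iff_forall _).2 fun x hx => ?_
          have h : 1 = φ x := mem_graph.1 (mem_rightKer.1 hx)
          exact (map_eq_one_iff φ φ.injective).1 h.symm
        simp [overlap, this]
      rw [if_pos h1, h2, weight_mk_graph]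
      simp
    · intro M _ hM
      rw [if_neg]
      rintro rfl
      refine hM ?_
      ext a
      simp [relComp_graph_left]
    · simp
  · intro L _ hL
    refine Finset.sum_eq_zero fun M _ => ?_
    rw [weight_mk_graph, if_neg hL.symm]
    simp
  · simp

theorem weight_mul_graph (φ : MulAut G) (P : Subgroup (G × G)) (a : B G G) :
    weight P (a * B.mk (ofSubgroup (graph φ))) = weight (relComp P (graph φ⁻¹)) a := by
  have hd : B.dual (B.mk (ofSubgroup (graph φ))) = B.mk (ofSubgroup (graph φ⁻¹)) := by
    rw [mk_graph, mk_graph, B.dual_mk, B.mk_eq (opp_ofHoms_aut φ)]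
  rw [← B.dual_dual (a * _), weight_dual, B.dual_mul, hd, weight_graph_mul, weight_dual]
  congr 2
  ext a
  rw [mem_converse, relComp_graph_left, relComp_graph_right, inv_inv]
  exact mem_converse

end

noncomputable section

open scoped Classical

variable {G : Type u} [CommGroup G]

/-! ### Orthogonality relations for the weights -/

/-- The restriction of a relation to second coordinates in `H`. -/
def corestrict (H : Subgroup G) (L : Subgroup (G × G)) : Subgroup (G × G) :=
  L ⊓ (⊤ : Subgroup G).prod H

theorem mem_corestrict {H : Subgroup G} {L : Subgroup (G × G)} {a : G × G} :
    a ∈ corestrict H L ↔ a ∈ L ∧ a.2 ∈ H := by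
  simp [corestrict, Subgroup.mem_prod]

/-- The relation `P` is the graph of a surjection onto `H` from a subquotient of `G`, in the sense
that its right kernel is trivial and its second projection covers `H`. -/
def IsSlice (H : Subgroup G) (P : Subgroup (G × G)) : Prop :=
  rightKer P = ⊥ ∧ ∀ h ∈ H, ∃ g, (g, h) ∈ P

theorem rightKer_eq_bot_iff {L : Subgroup (G × G)} :
    rightKer L = ⊥ ↔ ∀ x, ((1, x) : G × G) ∈ L → x = 1 :=
  Subgroup.eq_bot_iff_forall _

theorem leftKer_eq_bot_iff {L : Subgroup (G × G)} :
    leftKer L = ⊥ ↔ ∀ x, ((x, 1) : G × G) ∈ L → x = 1 :=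
  Subgroup.eq_bot_iff_forall _

theorem leftKer_corestrict (H : Subgroup G) (L : Subgroup (G × G)) :
    leftKer (corestrict H L) = leftKer L := by
  ext x
  simp [mem_leftKer, mem_corestrict, one_mem]

theorem corestrict_top (L : Subgroup (G × G)) : corestrict ⊤ L = L := by
  ext a
  simp [mem_corestrict]

theorem leftKer_graph_one : leftKer (graph (1 : MulAut G)) = ⊥ :=
  leftKer_eq_bot_iff.2 fun _ h => mem_graph_one.1 h

theorem rightKer_graph_one : rightKer (graph (1 : MulAut G)) = ⊥ :=
  rightKer_eq_bot_iff.2 fun _ h => (mem_graph_one.1 h).symm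

theorem isSlice_corestrict_graph_one (H : Subgroup G) :
    IsSlice H (corestrict H (graph 1)) := by
  refine ⟨rightKer_eq_bot_iff.2 fun x hx => ?_, fun h hh =>
    ⟨h, mem_corestrict.2 ⟨mem_graph_one.2 rfl, hh⟩⟩⟩
  exact (mem_graph_one.1 (mem_corestrict.1 hx).1).symm

/-- In a group whose subgroups form a chain, the composite of the converse of `L` with `M` restricts
to the identity of `H` only if `L` and `M` have the same restriction, which is a slice. -/
theorem relComp_converse_inf_eq_iff (hc : ∀ A B : Subgroup G, A ≤ B ∨ B ≤ A) {H : Subgroup G}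
    (hH : H ≠ ⊥) (L M : Subgroup (G × G)) :
    relComp (converse L) M ⊓ H.prod H = graph 1 ⊓ H.prod H ↔
      corestrict H L = corestrict H M ∧ IsSlice H (corestrict H L) := by
  have key : relComp (converse L) M ⊓ H.prod H = graph 1 ⊓ H.prod H ↔
      ∀ x ∈ H, ∀ z ∈ H, (∃ g, (g, x) ∈ L ∧ (g, z) ∈ M) ↔ x = z := by
    constructor
    · intro h x hx z hz
      have := SetLike.ext_iff.1 h (x, z)
      simpa [Subgroup.mem_inf, Subgroup.mem_prod, hx, hz, mem_relComp, mem_converse,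
        mem_graph_one] using this
    · intro h
      ext ⟨x, z⟩
      simp only [Subgroup.mem_inf, Subgroup.mem_prod, mem_relComp, mem_converse, mem_graph_one]
      constructor
      · rintro ⟨h1, hx, hz⟩
        exact ⟨(h x hx z hz).1 h1, hx, hz⟩
      · rintro ⟨h1, hx, hz⟩
        exact ⟨(h x hx z hz).2 h1, hx, hz⟩
  rw [key]
  constructor
  · intro h
    have kL : ∀ x ∈ H, ((1, x) : G × G) ∈ L → x = 1 := fun x hx hL =>
      (h x hx 1 (one_mem H)).1 ⟨1, hL, one_mem M⟩
    have kM : ∀ x ∈ H, ((1, x) : G × G) ∈ M → x = 1 := fun x hx hM =>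
      ((h 1 (one_mem H) x hx).1 ⟨1, one_mem L, hM⟩).symm
    have cover : ∀ x ∈ H, ∃ g, (g, x) ∈ L ∧ (g, x) ∈ M := fun x hx => (h x hx x hx).2 rfl
    have main : ∀ A B : Subgroup (G × G), (∀ x ∈ H, ((1, x) : G × G) ∈ A → x = 1) →
        (∀ x ∈ H, ∃ g, (g, x) ∈ A ∧ (g, x) ∈ B) → corestrict H A ≤ corestrict H B := by
      intro A B kA cov a ha
      obtain ⟨haA, haH⟩ := mem_corestrict.1 ha
      refine mem_corestrict.2 ⟨?_, haH⟩
      -- The chain condition compares `leftKer A` with the first projection `C` of the common part.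
      -- If `leftKer A ≤ C`, a partner `y` in `H` of an element of `leftKer A` must be trivial. If
      -- `C ≤ leftKer A`, every `x` in `H` satisfies `(1, x) ∈ A`, which forces `H` to be trivial.
      have hker : ∀ k, ((k, 1) : G × G) ∈ A → ((k, 1) : G × G) ∈ B := by
        let C : Subgroup G := (corestrict H A ⊓ corestrict H B).map (MonoidHom.fst G G)
        rcases hc (leftKer A) C with h1 | h1
        · intro k hk
          obtain ⟨⟨k', y⟩, hy, rfl⟩ := h1 hk
          obtain ⟨hyA, hyB⟩ := Subgroup.mem_inf.1 hy
          obtain ⟨hyA, hyH⟩ := mem_corestrict.1 hyA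
          have e : ((1, y) : G × G) ∈ A := by
            have := mul_mem hyA (inv_mem hk)
            simpa using this
          have : y = 1 := kA y hyH e
          subst this
          exact (mem_corestrict.1 hyB).1
        · exfalso
          refine hH ((Subgroup.eq_bot_iff_forall _).2 fun x hx => ?_)
          obtain ⟨g, hgA, hgB⟩ := cov x hx
          have hg : g ∈ leftKer A := h1 ⟨(g, x), Subgroup.mem_inf.2
            ⟨mem_corestrict.2 ⟨hgA, hx⟩, mem_corestrict.2 ⟨hgB, hx⟩⟩, rfl⟩
          refine kA x hx ?_
          have := mul_mem hgA (inv_mem (mem_leftKer.1 hg))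
          simpa using this
      -- Dividing `a` by a common element of `A` and `B` over the same second coordinate leaves an
      -- element of `leftKer A`, which `hker` puts into `B`.
      obtain ⟨g, hgA, hgB⟩ := cov a.2 haH
      have h1 : ((a.1 * g⁻¹, 1) : G × G) ∈ A := by
        have := mul_mem haA (inv_mem hgA)
        simpa [Prod.mul_def] using this
      have := mul_mem (hker _ h1) hgB
      simpa [Prod.mul_def] using this
    have e : corestrict H L = corestrict H M :=
      le_antisymm (main L M kL cover) (main M L kM fun x hx =>
        (cover x hx).imp fun g hg => hg.symm)
    refine ⟨e, rightKer_eq_bot_iff.2 fun x hx => ?_, fun x hx => ?_⟩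
    · obtain ⟨h1, h2⟩ := mem_corestrict.1 hx
      exact kL x h2 h1
    · obtain ⟨g, hg, -⟩ := cover x hx
      exact ⟨g, mem_corestrict.2 ⟨hg, hx⟩⟩
  · rintro ⟨e, hk, hs⟩ x hx z hz
    constructor
    · rintro ⟨g, h1, h2⟩
      have h2' : (g, z) ∈ corestrict H L := e ▸ mem_corestrict.2 ⟨h2, hz⟩
      have h1' : (g, x) ∈ corestrict H L := mem_corestrict.2 ⟨h1, hx⟩
      have := mul_mem h1' (inv_mem h2')
      have := rightKer_eq_bot_iff.1 hk (x * z⁻¹) (by simpa using this)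
      exact mul_inv_eq_one.1 this
    · rintro rfl
      obtain ⟨g, hg⟩ := hs x hx
      exact ⟨g, (mem_corestrict.1 hg).1, (mem_corestrict.1 (e ▸ hg)).1⟩

theorem top_ne_bot_of_ne_bot {H : Subgroup G} (hH : H ≠ ⊥) : (⊤ : Subgroup G) ≠ ⊥ :=
  fun h => hH (le_bot_iff.1 (h ▸ le_top))

/-- Two nontrivial subgroups in a chain meet nontrivially, so a right kernel that meets `H`
trivially is trivial. -/
theorem rightKer_eq_bot_of_corestrict (hc : ∀ A B : Subgroup G, A ≤ B ∨ B ≤ A) {H : Subgroup G}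
    (hH : H ≠ ⊥) {L : Subgroup (G × G)} (h : rightKer (corestrict H L) = ⊥) : rightKer L = ⊥ := by
  rw [rightKer_eq_bot_iff] at h
  rcases hc (rightKer L) H with h1 | h1
  · exact rightKer_eq_bot_iff.2 fun x hx => h x (mem_corestrict.2 ⟨hx, h1 hx⟩)
  · refine absurd ((Subgroup.eq_bot_iff_forall _).2 fun x hx => ?_) hH
    exact h x (mem_corestrict.2 ⟨h1 hx, hx⟩)

/-! ### Quadratic identities and slice weights -/

variable [Finite G]

theorem sum_weight_one (κ : Subgroup (G × G) → ℚ) :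
    ∑ P, κ P * weight P (1 : B G G) = κ (graph 1) := by
  simp [weight_one]

/-- This is `u° u = 1` summed against `κ`. Passing to `u°` replaces the first relation by its
converse, so the overlap becomes the intersection of two left kernels. -/
theorem sum_orthogonality {u : B G G} (hu : B.dual u * u = 1) (κ : Subgroup (G × G) → ℚ) :
    ∑ L, ∑ M, κ (relComp (converse L) M) *
      (Nat.card (leftKer L ⊓ leftKer M : Subgroup G) * weight L u * weight M u) =
        κ (graph 1) := by
  rw [← sum_weight_one κ, ← hu, sum_mul_weight_mul]
  refine Fintype.sum_equiv ⟨converse, converse, converse_converse, converse_converse⟩ _ _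
    fun L => Finset.sum_congr rfl fun M _ => ?_
  rw [weight_dual]
  rfl

/-- The sum of the weights of all relations with the given restriction to `H`. -/
def sliceWeight (H : Subgroup G) (u : B G G) (P : Subgroup (G × G)) : ℚ :=
  ∑ L, if corestrict H L = P then weight L u else 0

/-- Take for `κ` the indicator of the relations agreeing with the diagonal on `H × H`. By
`relComp_converse_inf_eq_iff` only pairs with the same restriction to `H`, a slice, contribute, and
the double sum collapses into squares. -/
theorem sum_sliceWeight_sq (hc : ∀ A B : Subgroup G, A ≤ B ∨ B ≤ A) {u : B G G}
    (hu : B.dual u * u = 1) {H : Subgroup G} (hH : H ≠ ⊥) :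
    ∑ P, (if IsSlice H P then (Nat.card (leftKer P) : ℚ) * sliceWeight H u P ^ 2 else 0) = 1 := by
  have h := sum_orthogonality hu
    (fun R => if R ⊓ H.prod H = graph 1 ⊓ H.prod H then 1 else 0)
  rw [if_pos rfl] at h
  rw [← h]
  have e : ∀ P, (if IsSlice H P then (Nat.card (leftKer P) : ℚ) * sliceWeight H u P ^ 2 else 0) =
      ∑ L, ∑ M, if corestrict H L = P then if corestrict H M = P then if IsSlice H P then
        (Nat.card (leftKer P) : ℚ) * (weight L u * weight M u) else 0 else 0 else 0 := by
    intro P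
    split_ifs with hP
    · rw [sliceWeight, sq, Finset.sum_mul_sum, Finset.mul_sum]
      refine Finset.sum_congr rfl fun L _ => ?_
      rw [Finset.mul_sum]
      refine Finset.sum_congr rfl fun M _ => ?_
      split_ifs <;> simp
    · simp
  rw [Finset.sum_congr rfl fun P _ => e P, Finset.sum_comm]
  refine Finset.sum_congr rfl fun L _ => ?_
  rw [Finset.sum_comm]
  refine Finset.sum_congr rfl fun M _ => ?_
  rw [Finset.sum_ite_eq, if_pos (Finset.mem_univ _)]
  by_cases hLM : corestrict H L = corestrict H M
  -- Restricting second coordinates does not change the left kernel, so the factor `|leftKer L ⊓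
  -- leftKer M|` depends on the common slice alone.
  · have hk : leftKer M = leftKer L := by
      rw [← leftKer_corestrict H, ← hLM, leftKer_corestrict]
    rw [if_pos hLM.symm, hk, inf_idem, leftKer_corestrict]
    by_cases hs : IsSlice H (corestrict H L)
    · rw [if_pos hs, if_pos ((relComp_converse_inf_eq_iff hc hH L M).2 ⟨hLM, hs⟩)]
      ring
    · rw [if_neg hs, if_neg fun h => hs ((relComp_converse_inf_eq_iff hc hH L M).1 h).2]
      ring
  · rw [if_neg (Ne.symm hLM), if_neg fun h => hLM ((relComp_converse_inf_eq_iff hc hH L M).1 h).1]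
    ring

theorem sliceWeight_top (u : B G G) (P : Subgroup (G × G)) : sliceWeight ⊤ u P = weight P u := by
  simp [sliceWeight, corestrict_top]

/-- If one slice weight has square at least `1`, then the others vanish. -/
theorem sliceWeight_eq_zero (hc : ∀ A B : Subgroup G, A ≤ B ∨ B ≤ A) {u : B G G}
    (hu : B.dual u * u = 1) {H : Subgroup G} (hH : H ≠ ⊥) {P Q : Subgroup (G × G)}
    (hP : IsSlice H P) (hQ : IsSlice H Q) (hQ1 : 1 ≤ sliceWeight H u Q ^ 2) (hne : P ≠ Q) :
    sliceWeight H u P = 0 := by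
  have h := sum_sliceWeight_sq hc hu hH
  have pos : ∀ P : Subgroup (G × G), (1 : ℚ) ≤ Nat.card (leftKer P) := fun P => by
    exact_mod_cast Nat.card_pos
  have nonneg : ∀ R ∈ (Finset.univ : Finset (Subgroup (G × G))), (0 : ℚ) ≤
      if IsSlice H R then (Nat.card (leftKer R) : ℚ) * sliceWeight H u R ^ 2 else 0 := fun R _ => by
    split_ifs <;> positivity
  have h2 := Finset.add_le_sum nonneg (Finset.mem_univ P) (Finset.mem_univ Q) hne
  rw [h, if_pos hP, if_pos hQ] at h2
  have h3 := pos P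
  have h4 := pos Q
  -- The term of `Q` already exhausts the total `1`, leaving nothing for `P`.
  have h5 : sliceWeight H u P ^ 2 ≤ 0 := by nlinarith [sq_nonneg (sliceWeight H u P)]
  exact pow_eq_zero_iff (two_ne_zero) |>.1 (le_antisymm h5 (sq_nonneg _))

theorem sliceWeight_sq_le_one (hc : ∀ A B : Subgroup G, A ≤ B ∨ B ≤ A) {u : B G G}
    (hu : B.dual u * u = 1) {H : Subgroup G} (hH : H ≠ ⊥) {P : Subgroup (G × G)}
    (hP : IsSlice H P) : sliceWeight H u P ^ 2 ≤ 1 := by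
  have h := sum_sliceWeight_sq hc hu hH
  have nonneg : ∀ R ∈ (Finset.univ : Finset (Subgroup (G × G))), (0 : ℚ) ≤
      if IsSlice H R then (Nat.card (leftKer R) : ℚ) * sliceWeight H u R ^ 2 else 0 := fun R _ => by
    split_ifs <;> positivity
  have h2 := Finset.single_le_sum nonneg (Finset.mem_univ P)
  rw [h, if_pos hP] at h2
  have h3 : (1 : ℚ) ≤ Nat.card (leftKer P) := by exact_mod_cast Nat.card_pos
  nlinarith [sq_nonneg (sliceWeight H u P)]

theorem weight_eq_zero_of_isSlice_top (hc : ∀ A B : Subgroup G, A ≤ B ∨ B ≤ A) {u : B G G}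
    (hu : B.dual u * u = 1) (hG : (⊤ : Subgroup G) ≠ ⊥) (hu1 : weight (graph 1) u ^ 2 = 1)
    {P : Subgroup (G × G)} (hP : IsSlice ⊤ P) (hne : P ≠ graph 1) : weight P u = 0 := by
  rw [← sliceWeight_top]
  refine sliceWeight_eq_zero hc hu hG hP (Q := graph 1) ?_ ?_ hne
  · exact corestrict_top (graph (1 : MulAut G)) ▸ isSlice_corestrict_graph_one ⊤
  · rw [sliceWeight_top, hu1]

/-- The factor `|G| / |L|` is a power of `p`, with positive exponent because `L` is smaller than
`G`. -/
theorem exists_weight_eq_prime_mul {p n : ℕ} (hp : p.Prime) (hG : Nat.card G = p ^ n)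
    (u : B G G) {L : Subgroup (G × G)} (hL : Nat.card L < Nat.card G) :
    ∃ m : ℤ, weight L u = p * m := by
  obtain ⟨c, -, hw⟩ := B.exists_eq_sum_basis u
  have hd : Nat.card L ∣ p ^ (n + n) := by
    rw [pow_add, ← hG, ← Nat.card_prod]
    exact Subgroup.card_subgroup_dvd_card L
  obtain ⟨k, -, hk⟩ := (Nat.dvd_prime_pow hp).1 hd
  rw [hk, hG] at hL
  have hkn : k < n := (Nat.pow_lt_pow_iff_right hp.one_lt).1 hL
  refine ⟨c L * p ^ (n - k - 1), ?_⟩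
  have hp0 : (p : ℚ) ≠ 0 := Nat.cast_ne_zero.2 hp.ne_zero
  rw [hw, hk, hG]
  obtain ⟨j, rfl⟩ : ∃ j, n = k + j + 1 := ⟨n - k - 1, by omega⟩
  rw [show k + j + 1 - k - 1 = j by omega]
  push_cast
  field_simp
  ring

/-- Modulo `p` only the full diagonal contributes to this sum, with weight `1`. An integer congruent
to `1` modulo `p ≥ 3` with square at most `1` equals `1`; for `p = 2` the value `-1` would also
pass. -/
theorem sliceWeight_corestrict_graph_one (hc : ∀ A B : Subgroup G, A ≤ B ∨ B ≤ A) {p n : ℕ}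
    (hp : p.Prime) (hp3 : 3 ≤ p) (hG : Nat.card G = p ^ n) {u : B G G} (hu : B.dual u * u = 1)
    (hu1 : weight (graph 1) u = 1) {H : Subgroup G} (hH : H ≠ ⊥) :
    sliceWeight H u (corestrict H (graph 1)) = 1 := by
  have each : ∀ L ≠ graph (1 : MulAut G), ∃ m : ℤ,
      (if corestrict H L = corestrict H (graph 1) then weight L u else 0) = p * m := by
    intro L hne
    split_ifs with hL
    · have hk : rightKer L = ⊥ := rightKer_eq_bot_of_corestrict hc hH
        (hL ▸ (isSlice_corestrict_graph_one H).1)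
      have hk' : leftKer L = ⊥ := by
        rw [← leftKer_corestrict H, hL, leftKer_corestrict, leftKer_graph_one]
      -- Either `L` is the graph of an automorphism other than the identity, excluded by the case `H
      -- = G`, or it has fewer than `|G|` elements and its weight is divisible by `p`.
      by_cases hs : IsSlice ⊤ L
      · refine ⟨0, ?_⟩
        rw [weight_eq_zero_of_isSlice_top hc hu (top_ne_bot_of_ne_bot hH) (by simp [hu1]) hs hne]
        simp
      · refine exists_weight_eq_prime_mul hp hG u ?_
        let f : L → G := fun a => a.1.2
        have inj : Function.Injective f := by
          rintro ⟨⟨x, y⟩, ha⟩ ⟨⟨x', y'⟩, hb⟩ (rfl : y = y')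
          have := mul_mem ha (inv_mem hb)
          have := leftKer_eq_bot_iff.1 hk' (x * x'⁻¹) (by simpa using this)
          rw [mul_inv_eq_one] at this
          subst this
          rfl
        -- If `|L| = |G|`, the injective second projection would be onto and `L` a slice over `⊤`.
        refine (Nat.card_le_card_of_injective f inj).lt_of_ne fun he => hs ⟨hk, fun h _ => ?_⟩
        obtain ⟨⟨⟨g, _⟩, ha⟩, rfl⟩ :=
          ((Nat.bijective_iff_injective_and_card f).2 ⟨inj, he⟩).2 h
        exact ⟨g, ha⟩
    · exact ⟨0, by simp⟩
  choose! m hm using each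
  have e : sliceWeight H u (corestrict H (graph 1)) =
      1 + p * ((∑ L ∈ Finset.univ.erase (graph (1 : MulAut G)), m L : ℤ) : ℚ) := by
    rw [sliceWeight, ← Finset.add_sum_erase _ _ (Finset.mem_univ (graph (1 : MulAut G))),
      if_pos rfl, hu1, Int.cast_sum, Finset.mul_sum]
    exact congrArg _ (Finset.sum_congr rfl fun L hL => hm L (Finset.ne_of_mem_erase hL))
  have hle := sliceWeight_sq_le_one hc hu hH (isSlice_corestrict_graph_one H)
  rw [e] at hle ⊢
  generalize (∑ L ∈ Finset.univ.erase (graph (1 : MulAut G)), m L : ℤ) = t at *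
  have hle' : (1 + p * t) ^ 2 ≤ (1 : ℤ) := by exact_mod_cast hle
  obtain ⟨h1, h2⟩ := abs_le.1 ((sq_le_one_iff_abs_le_one _).1 hle')
  have hp3' : (3 : ℤ) ≤ p := by exact_mod_cast hp3
  have ht : t = 0 := by
    by_contra ht
    rcases lt_or_gt_of_ne ht with h | h <;> nlinarith
  simp [ht]

/-- The weights of the relations with trivial right kernel and nontrivial second projection. -/
theorem weight_eq_of_rightKer_eq_bot_of_ne (hc : ∀ A B : Subgroup G, A ≤ B ∨ B ≤ A) {p n : ℕ}
    (hp : p.Prime) (hp3 : 3 ≤ p) (hG : Nat.card G = p ^ n) {u : B G G} (hu : B.dual u * u = 1)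
    (hu1 : weight (graph 1) u = 1) {L : Subgroup (G × G)} (hk : rightKer L = ⊥)
    (hL : L.map (MonoidHom.snd G G) ≠ ⊥) :
    weight L u = if L = graph 1 then 1 else 0 := by
  -- Descending induction: relations with larger second projection are treated first.
  induction hH : L.map (MonoidHom.snd G G) using WellFoundedGT.induction generalizing L with
  | _ H ih =>
    rw [hH] at hL
    have memH : ∀ a ∈ L, a.2 ∈ H := fun a ha => hH ▸ ⟨a, ha, rfl⟩
    have self : corestrict H L = L := by
      ext a
      rw [mem_corestrict]
      exact ⟨fun h => h.1, fun h => ⟨h, memH a h⟩⟩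
    have hs : IsSlice H L := ⟨hk, fun h hh => by
      rw [← hH] at hh
      obtain ⟨a, ha, rfl⟩ := hh
      exact ⟨a.1, ha⟩⟩
    have other : ∀ L' ≠ L, corestrict H L' = L → weight L' u = if L' = graph 1 then 1 else 0 := by
      intro L' hne hL'
      have hlt : H < L'.map (MonoidHom.snd G G) := by
        refine lt_of_le_not_ge ?_ fun hle => hne ?_
        · rw [← hH]
          refine Subgroup.map_mono ?_
          rw [← hL']
          exact inf_le_left
        · rw [← hL']
          ext a
          rw [mem_corestrict]
          exact ⟨fun h => ⟨h, hle ⟨a, h, rfl⟩⟩, fun h => h.1⟩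
      exact ih _ hlt (rightKer_eq_bot_of_corestrict hc hL (hL'.symm ▸ hk))
        (ne_bot_of_gt hlt) rfl
    have h1 := sliceWeight_corestrict_graph_one hc hp hp3 hG hu hu1 hL
    by_cases hL1 : L = graph 1
    · rw [if_pos hL1, hL1, hu1]
    · rw [if_neg hL1]
      -- By `other`, among the relations restricting to `L` only `L` itself and possibly the
      -- diagonal can have nonzero weight.
      have e : sliceWeight H u L = weight L u + if corestrict H (graph 1) = L then 1 else 0 := by
        have : ∀ L', (if corestrict H L' = L then weight L' u else 0) =
            (if L' = L then weight L u else 0) +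
              if L' = graph 1 then if corestrict H (graph 1) = L then 1 else 0 else 0 := by
          intro L'
          by_cases h2 : L' = L
          · subst h2
            rw [if_pos self, if_pos rfl, if_neg hL1, add_zero]
          · rw [if_neg h2, zero_add]
            by_cases h3 : corestrict H L' = L
            · rw [if_pos h3, other L' h2 h3]
              split_ifs with h4 h5
              · rfl
              · exact absurd (h4 ▸ h3) h5
              · rfl
            · rw [if_neg h3]
              split_ifs with h4 h5
              · exact absurd h5 (h4 ▸ h3)
              · rfl
              · rfl
        rw [sliceWeight, Finset.sum_congr rfl fun L' _ => this L', Finset.sum_add_distrib]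
        simp
      -- If `L` is the restricted diagonal, its slice weight `1` is already supplied by the full
      -- diagonal. Otherwise its slice weight vanishes.
      split_ifs at e with h2
      · rw [h2] at h1
        linarith
      · rw [← add_zero (weight L u), ← e]
        exact sliceWeight_eq_zero hc hu hL hs (isSlice_corestrict_graph_one H)
          (by rw [h1]; norm_num) (Ne.symm h2)

end

noncomputable section

open scoped Classical

variable {G : Type u} [CommGroup G]

/-! ### The relations `K × 1` -/

/-- A weight function on relations that detects the part of `B(G, G)` not factoring through
`G / N`. -/
def primitiveWeight (p : ℕ) (N : Subgroup G) (R : Subgroup (G × G)) : ℚ :=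
  if leftKer R ≠ ⊥ ∨ rightKer R ≠ ⊥ then 0 else if R ⊓ N.prod N ≠ ⊥ then p else p - 1

theorem graph_one_ne_prod_bot (hG : (⊤ : Subgroup G) ≠ ⊥) (K : Subgroup G) :
    graph (1 : MulAut G) ≠ K.prod ⊥ := fun h => hG <| (Subgroup.eq_bot_iff_forall _).2 fun x _ => by
  have hx : (x, x) ∈ K.prod (⊥ : Subgroup G) := h ▸ mem_graph_one.2 rfl
  exact Subgroup.mem_bot.1 (Subgroup.mem_prod.1 hx).2

theorem leftKer_prod_bot (K : Subgroup G) : leftKer (K.prod (⊥ : Subgroup G)) = K := by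
  ext x
  simp [mem_leftKer, Subgroup.mem_prod]

theorem eq_prod_bot {L : Subgroup (G × G)} (hL : L.map (MonoidHom.snd G G) = ⊥) :
    L = (leftKer L).prod ⊥ := by
  have h : ∀ a ∈ L, a.2 = 1 := fun a ha => Subgroup.mem_bot.1 (hL ▸ ⟨a, ha, rfl⟩)
  ext ⟨x, y⟩
  rw [Subgroup.mem_prod, mem_leftKer, Subgroup.mem_bot]
  constructor
  · intro hxy
    obtain rfl : y = 1 := h _ hxy
    exact ⟨hxy, rfl⟩
  · rintro ⟨h1, rfl : y = 1⟩
    exact h1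

theorem relComp_converse_prod_bot (K K' : Subgroup G) :
    relComp (converse (K.prod ⊥)) (K'.prod (⊥ : Subgroup G)) = ⊥ := by
  refine (Subgroup.eq_bot_iff_forall _).2 ?_
  rintro ⟨x, z⟩ ⟨y, h1, h2⟩
  exact Prod.ext (Subgroup.mem_bot.1 (Subgroup.mem_prod.1 h1).2)
    (Subgroup.mem_bot.1 (Subgroup.mem_prod.1 h2).2)

theorem relComp_converse_graph_one_left (L : Subgroup (G × G)) :
    relComp (converse (graph 1)) L = L := by
  ext a
  rw [mem_relComp]
  constructor
  · rintro ⟨y, h1, h2⟩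
    have h1 : y = a.1 := mem_graph_one.1 h1
    rwa [h1] at h2
  · exact fun h => ⟨a.1, mem_graph_one.2 rfl, h⟩

theorem relComp_graph_one_right (L : Subgroup (G × G)) : relComp L (graph 1) = L := by
  ext a
  exact relComp_graph_right 1 L

theorem primitiveWeight_bot (p : ℕ) (N : Subgroup G) : primitiveWeight p N ⊥ = p - 1 := by
  have h1 : leftKer (⊥ : Subgroup (G × G)) = ⊥ :=
    leftKer_eq_bot_iff.2 fun x hx => (Prod.ext_iff.1 (Subgroup.mem_bot.1 hx)).1
  have h2 : rightKer (⊥ : Subgroup (G × G)) = ⊥ :=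
    rightKer_eq_bot_iff.2 fun x hx => (Prod.ext_iff.1 (Subgroup.mem_bot.1 hx)).2
  simp [primitiveWeight, h1, h2]

theorem primitiveWeight_graph_one (p : ℕ) {N : Subgroup G} (hN : N ≠ ⊥) :
    primitiveWeight p N (graph 1) = p := by
  have h : graph (1 : MulAut G) ⊓ N.prod N ≠ ⊥ := fun h => hN <|
    (Subgroup.eq_bot_iff_forall _).2 fun x hx => by
      have : (x, x) ∈ graph (1 : MulAut G) ⊓ N.prod N :=
        Subgroup.mem_inf.2 ⟨mem_graph_one.2 rfl, Subgroup.mem_prod.2 ⟨hx, hx⟩⟩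
      rw [h] at this
      exact (Prod.ext_iff.1 (Subgroup.mem_bot.1 this)).1
  rw [primitiveWeight, leftKer_graph_one, rightKer_graph_one, if_neg (by simp), if_pos h]

theorem primitiveWeight_eq_zero {p : ℕ} {N : Subgroup G} {R : Subgroup (G × G)}
    (h : leftKer R ≠ ⊥ ∨ rightKer R ≠ ⊥) : primitiveWeight p N R = 0 := if_pos h

variable [Finite G]

/-- The subgroup of prime order is the least nontrivial member of the chain, so a nontrivial kernel
contains it. -/
theorem le_of_ne_bot (hc : ∀ A B : Subgroup G, A ≤ B ∨ B ≤ A) {p : ℕ} (hp : p.Prime)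
    {N : Subgroup G} (hN : Nat.card N = p) {K : Subgroup G} (hK : K ≠ ⊥) : N ≤ K := by
  rcases hc N K with h | h
  · exact h
  · have hd := Subgroup.card_dvd_of_le h
    rw [hN] at hd
    rcases (Nat.dvd_prime hp).1 hd with h1 | h1
    · exact absurd (Subgroup.card_eq_one.1 h1) hK
    · exact (Subgroup.eq_of_le_of_card_ge h (hN.trans h1.symm).le).ge

/-- Bookkeeping for the last test function: the diagonal and the relations `K × 1` are the only
relations that can still contribute. -/
theorem sum_eq_graph_one_add_sum_prod_bot (hG : (⊤ : Subgroup G) ≠ ⊥)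
    (F : Subgroup (G × G) → ℚ)
    (hF : ∀ L, L ≠ graph 1 → (∀ K : Subgroup G, L ≠ K.prod ⊥) → F L = 0) :
    ∑ L, F L = F (graph 1) + ∑ K : Subgroup G, F (K.prod ⊥) := by
  have inj : Function.Injective fun K : Subgroup G => K.prod (⊥ : Subgroup G) := fun K K' h => by
    rw [← leftKer_prod_bot K, ← leftKer_prod_bot K', show K.prod (⊥ : Subgroup G) = K'.prod ⊥ from h]
  have hn : graph (1 : MulAut G) ∉
      Finset.univ.image fun K : Subgroup G => K.prod (⊥ : Subgroup G) := by
    rw [Finset.mem_image]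
    rintro ⟨K, -, h⟩
    exact graph_one_ne_prod_bot hG K h.symm
  rw [← Finset.sum_subset (Finset.subset_univ
    (insert (graph 1) (Finset.univ.image fun K : Subgroup G => K.prod (⊥ : Subgroup G))))]
  · rw [Finset.sum_insert hn, Finset.sum_image fun _ _ _ _ h => inj h]
  · intro L _ hL
    rw [Finset.mem_insert, Finset.mem_image, not_or] at hL
    exact hF L hL.1 fun K h => hL.2 ⟨K, Finset.mem_univ _, h.symm⟩

/-- Orthogonality tested against `primitiveWeight`. The diagonal paired with itself cancels the
right-hand side; paired with `K × 1` it survives only for `K = 1`, once on each side, whence `2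
c_1`. Two relations `K × 1` and `K' × 1` compose to the trivial relation. -/
theorem two_mul_weight_bot_add_sum (hc : ∀ A B : Subgroup G, A ≤ B ∨ B ≤ A) {p n : ℕ}
    (hp : p.Prime) (hp3 : 3 ≤ p) (hG : Nat.card G = p ^ n) {N : Subgroup G} (hN : N ≠ ⊥)
    {u : B G G} (hu : B.dual u * u = 1) (hu1 : weight (graph 1) u = 1) :
    2 * weight ((⊥ : Subgroup G).prod ⊥) u + ∑ K : Subgroup G, ∑ K' : Subgroup G,
      (Nat.card (K ⊓ K' : Subgroup G) : ℚ) *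
        (weight (K.prod ⊥) u * weight (K'.prod ⊥) u) = 0 := by
  have htop := top_ne_bot_of_ne_bot hN
  have h := sum_orthogonality hu (primitiveWeight p N)
  rw [primitiveWeight_graph_one p hN] at h
  -- A nontrivial right kernel of `L` survives as a left kernel of the composite, where
  -- `primitiveWeight` vanishes. With trivial right kernel, `weight L u` is zero by the previous
  -- results.
  have zl : ∀ L M : Subgroup (G × G), L ≠ graph 1 → (∀ K : Subgroup G, L ≠ K.prod ⊥) →
      primitiveWeight p N (relComp (converse L) M) * weight L u = 0 := by
    intro L M h1 h2
    by_cases hk : rightKer L = ⊥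
    · rw [weight_eq_of_rightKer_eq_bot_of_ne hc hp hp3 hG hu hu1 hk
        fun h => h2 _ (eq_prod_bot h), if_neg h1, mul_zero]
    · rw [primitiveWeight_eq_zero, zero_mul]
      refine Or.inl fun hb => hk (rightKer_eq_bot_iff.2 fun x hx => ?_)
      exact leftKer_eq_bot_iff.1 hb x ⟨1, hx, one_mem M⟩
  have zr : ∀ L M : Subgroup (G × G), M ≠ graph 1 → (∀ K : Subgroup G, M ≠ K.prod ⊥) →
      primitiveWeight p N (relComp (converse L) M) * weight M u = 0 := by
    intro L M h1 h2
    by_cases hk : rightKer M = ⊥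
    · rw [weight_eq_of_rightKer_eq_bot_of_ne hc hp hp3 hG hu hu1 hk
        fun h => h2 _ (eq_prod_bot h), if_neg h1, mul_zero]
    · rw [primitiveWeight_eq_zero, zero_mul]
      refine Or.inr fun hb => hk (rightKer_eq_bot_iff.2 fun x hx => ?_)
      exact rightKer_eq_bot_iff.1 hb x ⟨1, one_mem _, hx⟩
  have inner : ∀ L : Subgroup (G × G), ∑ M, primitiveWeight p N (relComp (converse L) M) *
      (Nat.card (leftKer L ⊓ leftKer M : Subgroup G) * weight L u * weight M u) =
      primitiveWeight p N (relComp (converse L) (graph 1)) * weight L u +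
      ∑ K : Subgroup G, primitiveWeight p N (relComp (converse L) (K.prod ⊥)) *
        (Nat.card (leftKer L ⊓ K : Subgroup G) * weight L u * weight (K.prod ⊥) u) := by
    intro L
    rw [sum_eq_graph_one_add_sum_prod_bot htop]
    · simp [leftKer_graph_one, hu1, leftKer_prod_bot]
    · intro M h1 h2
      linear_combination (Nat.card (leftKer L ⊓ leftKer M : Subgroup G) * weight L u) * zr L M h1 h2
  rw [Finset.sum_congr rfl fun L _ => inner L, sum_eq_graph_one_add_sum_prod_bot htop] at h
  · have e1 : ∀ K : Subgroup G, primitiveWeight p N (relComp (converse (graph 1)) (K.prod ⊥)) *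
        (Nat.card (leftKer (graph (1 : MulAut G)) ⊓ K : Subgroup G) * weight (graph 1) u *
          weight (K.prod ⊥) u) = if K = ⊥ then (p - 1) * weight ((⊥ : Subgroup G).prod ⊥) u
            else 0 := by
      intro K
      rw [relComp_converse_graph_one_left, leftKer_graph_one, hu1]
      split_ifs with hK
      · subst hK
        rw [Subgroup.bot_prod_bot, primitiveWeight_bot]
        simp
      · rw [primitiveWeight_eq_zero (Or.inl (by rwa [leftKer_prod_bot])), zero_mul]
    have e2 : ∀ K : Subgroup G, primitiveWeight p N (relComp (converse (K.prod ⊥)) (graph 1)) *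
        weight (K.prod ⊥) u = if K = ⊥ then (p - 1) * weight ((⊥ : Subgroup G).prod ⊥) u
            else 0 := by
      intro K
      rw [relComp_graph_one_right]
      split_ifs with hK
      · subst hK
        have : converse ((⊥ : Subgroup G).prod (⊥ : Subgroup G)) = ⊥ := by
          ext ⟨x, y⟩
          simp [mem_converse, and_comm]
        rw [this, primitiveWeight_bot]
      · rw [primitiveWeight_eq_zero (Or.inr (by rwa [rightKer_converse, leftKer_prod_bot])),
          zero_mul]
    rw [relComp_graph_one_right] at h
    have e0 : converse (graph (1 : MulAut G)) = graph 1 := by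
      ext a
      rw [mem_converse, mem_graph_one, mem_graph_one]
      exact eq_comm
    have e3 : ∀ K : Subgroup G, (primitiveWeight p N (relComp (converse (K.prod ⊥)) (graph 1)) *
        weight (K.prod ⊥) u + ∑ K' : Subgroup G,
          primitiveWeight p N (relComp (converse (K.prod ⊥)) (K'.prod ⊥)) *
          (Nat.card (leftKer (K.prod (⊥ : Subgroup G)) ⊓ K' : Subgroup G) * weight (K.prod ⊥) u *
            weight (K'.prod ⊥) u)) =
        (if K = ⊥ then (p - 1) * weight ((⊥ : Subgroup G).prod ⊥) u else 0) +
          (p - 1) * ∑ K' : Subgroup G, (Nat.card (K ⊓ K' : Subgroup G) : ℚ) *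
            (weight (K.prod ⊥) u * weight (K'.prod ⊥) u) := by
      intro K
      rw [e2, Finset.mul_sum]
      refine congrArg _ (Finset.sum_congr rfl fun K' _ => ?_)
      rw [relComp_converse_prod_bot, primitiveWeight_bot, leftKer_prod_bot]
      ring
    rw [Finset.sum_congr rfl fun K _ => e1 K, Finset.sum_congr rfl fun K _ => e3 K, e0,
      primitiveWeight_graph_one p hN, hu1, Finset.sum_add_distrib, ← Finset.mul_sum,
      Finset.sum_ite_eq', if_pos (Finset.mem_univ _)] at h
    -- After the diagonal term `p` cancels, every remaining term carries the factor `p - 1`, the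
    -- value at the trivial relation.
    have hp1 : (p : ℚ) - 1 ≠ 0 := by
      have : (3 : ℚ) ≤ p := by exact_mod_cast hp3
      linarith
    refine mul_left_cancel₀ hp1 ?_
    linear_combination h
  · intro L h1 h2
    rw [zl L _ h1 h2, zero_add]
    refine Finset.sum_eq_zero fun K _ => ?_
    linear_combination (Nat.card (leftKer L ⊓ K : Subgroup G) * weight (K.prod ⊥) u) *
      zl L (K.prod ⊥) h1 h2

/-- Since `|K ⊓ K'|` counts the elements lying in both subgroups, the quadratic form is a sum of
squares, and its positivity becomes available. -/
theorem sum_card_inf_mul (c : Subgroup G → ℚ) [Fintype G] :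
    ∑ K : Subgroup G, ∑ K' : Subgroup G, (Nat.card (K ⊓ K' : Subgroup G) : ℚ) * (c K * c K') =
      ∑ g : G, (∑ K : Subgroup G, if g ∈ K then c K else 0) ^ 2 := by
  simp_rw [sq, Finset.sum_mul_sum]
  rw [Finset.sum_comm (s := (Finset.univ : Finset G))]
  refine Finset.sum_congr rfl fun K _ => ?_
  rw [Finset.sum_comm]
  refine Finset.sum_congr rfl fun K' _ => ?_
  have : Nat.card (K ⊓ K' : Subgroup G) =
      (Finset.univ.filter fun g : G => g ∈ K ∧ g ∈ K').card := by
    rw [Nat.card_eq_fintype_card, Fintype.card_subtype]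
    congr 1
    ext g
    simp [Subgroup.mem_inf]
  rw [this, ← nsmul_eq_mul, ← Finset.sum_const, Finset.sum_filter]
  refine Finset.sum_congr rfl fun g _ => ?_
  by_cases h1 : g ∈ K <;> by_cases h2 : g ∈ K' <;> simp [h1, h2]

/-- In a cyclic group, a function on subgroups is determined by its sums over the subgroups that
contain a given element. -/
theorem eq_zero_of_sum_mem [IsCyclic G] {c : Subgroup G → ℚ}
    (h : ∀ g : G, (∑ K : Subgroup G, if g ∈ K then c K else 0) = 0) (K : Subgroup G) : c K = 0 := by
  induction K using WellFoundedGT.induction with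
  | _ K ih =>
    -- The subgroups containing a generator of `K` are those above `K`; descending induction kills
    -- all of them except `K` itself.
    obtain ⟨⟨g, hg⟩, hgen⟩ := IsCyclic.exists_generator (α := K)
    have hK : ∀ K' : Subgroup G, g ∈ K' → K ≤ K' := fun K' hg' x hx => by
      obtain ⟨k, hk⟩ := Subgroup.mem_zpowers_iff.1 (hgen ⟨x, hx⟩)
      have : g ^ k = x := congrArg Subtype.val hk
      exact this ▸ zpow_mem hg' k
    rw [← h g, Finset.sum_eq_single K, if_pos hg]
    · intro K' _ hne
      split_ifs with h'
      · exact ih K' (lt_of_le_of_ne (hK K' h') hne.symm)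
      · rfl
    · simp

/-- The identity `2 c_1 + ∑ d(g)² = 0` bounds `c_1`, while integrality makes `c_1` a multiple of
`|G|`. Together they give `c_1 = 0`, then `d = 0`, then `c = 0`. -/
theorem weight_prod_bot [IsCyclic G] (hc : ∀ A B : Subgroup G, A ≤ B ∨ B ≤ A) {p n : ℕ}
    (hp : p.Prime) (hp3 : 3 ≤ p) (hn : 1 < n) (hG : Nat.card G = p ^ n) {N : Subgroup G}
    (hN : Nat.card N = p) {u : B G G} (hu : B.dual u * u = 1) (hu1 : weight (graph 1) u = 1)
    (K : Subgroup G) : weight (K.prod ⊥) u = 0 := by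
  have := Fintype.ofFinite G
  have hN0 : N ≠ ⊥ := fun h => by
    rw [h, Subgroup.card_bot] at hN
    omega
  have h := two_mul_weight_bot_add_sum hc hp hp3 hG hN0 hu hu1
  set c : Subgroup G → ℚ := fun K => weight (K.prod ⊥) u with hcdef
  rw [sum_card_inf_mul c] at h
  set d : G → ℚ := fun g => ∑ K : Subgroup G, if g ∈ K then c K else 0 with hd
  have h' : 2 * c ⊥ + ∑ g, d g ^ 2 = 0 := h
  obtain ⟨m, -, hm⟩ := B.exists_eq_sum_basis u
  have hc0 : c ⊥ = m ((⊥ : Subgroup G).prod ⊥) * Nat.card G := by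
    rw [hcdef]
    simp only
    rw [hm, Subgroup.bot_prod_bot, Subgroup.card_bot]
    simp
  -- A nontrivial element of `N` lies in every subgroup except the trivial one, so `d 1` and `d g`
  -- differ exactly by `c ⊥`.
  obtain ⟨g, hgN, hg1⟩ := (Subgroup.ne_bot_iff_exists_ne_one).1 hN0 |>.elim fun g hg =>
    (⟨g.1, g.2, fun h => hg (Subtype.ext h)⟩ : ∃ g ∈ N, g ≠ 1)
  have hdiff : d 1 = c ⊥ + d g := by
    have e : ∀ K : Subgroup G, (if (1 : G) ∈ K then c K else 0) =
        (if K = ⊥ then c ⊥ else 0) + if g ∈ K then c K else 0 := by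
      intro K
      rw [if_pos (one_mem K)]
      by_cases hK : K = ⊥
      · subst hK
        rw [if_pos rfl, if_neg (by simpa using hg1), add_zero]
      · rw [if_neg hK, if_pos (le_of_ne_bot hc hp hN hK hgN), zero_add]
    rw [hd]
    simp only
    rw [Finset.sum_congr rfl fun K _ => e K, Finset.sum_add_distrib]
    simp
  have hle : d 1 ^ 2 + d g ^ 2 ≤ ∑ g, d g ^ 2 :=
    Finset.add_le_sum (fun g _ => sq_nonneg (d g)) (Finset.mem_univ _) (Finset.mem_univ _) hg1.symm
  have hbig : (9 : ℤ) ≤ Nat.card G := by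
    have h9 : 3 ^ 2 ≤ p ^ n := (Nat.pow_le_pow_left hp3 2).trans
      (Nat.pow_le_pow_right hp.pos hn)
    rw [hG]
    exact_mod_cast h9
  -- From `(d 1 - d g)² ≤ 2 (d 1² + d g²) ≤ -4 c ⊥`. Hence `c ⊥` lies between `-4` and `0`, while a
  -- nonzero multiple of `|G|` has absolute value at least `9`.
  have hq : c ⊥ ^ 2 ≤ -4 * c ⊥ := by nlinarith [sq_nonneg (d 1 + d g)]
  have hm0 : m ((⊥ : Subgroup G).prod ⊥) = 0 := by
    rw [hc0] at hq
    generalize m ((⊥ : Subgroup G).prod ⊥) = t at *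
    have hq' : (t * Nat.card G) ^ 2 ≤ -4 * (t * Nat.card G) := by exact_mod_cast hq
    by_contra ht
    have h1 : 9 ≤ |t * Nat.card G| := by
      rw [abs_mul, Nat.abs_cast]
      nlinarith [Int.one_le_abs ht, abs_nonneg t]
    rcases le_abs.1 h1 with h2 | h2 <;> nlinarith
  have hz : c ⊥ = 0 := by rw [hc0, hm0]; simp
  rw [hz, mul_zero, zero_add] at h'
  refine eq_zero_of_sum_mem (c := c) (fun g => ?_) K
  have := (Finset.sum_eq_zero_iff_of_nonneg fun g _ => sq_nonneg (d g)).1 h' g (Finset.mem_univ g)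
  exact pow_eq_zero_iff two_ne_zero |>.1 this

/-- The weights of the relations with trivial right kernel. -/
theorem weight_eq_of_rightKer_eq_bot [IsCyclic G] (hc : ∀ A B : Subgroup G, A ≤ B ∨ B ≤ A)
    {p n : ℕ} (hp : p.Prime) (hp3 : 3 ≤ p) (hn : 1 < n) (hG : Nat.card G = p ^ n)
    {N : Subgroup G} (hN : Nat.card N = p) {u : B G G} (hu : B.dual u * u = 1)
    (hu1 : weight (graph 1) u = 1) {L : Subgroup (G × G)} (hL : rightKer L = ⊥) :
    weight L u = weight L 1 := by
  rw [weight_one]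
  by_cases h : L.map (MonoidHom.snd G G) = ⊥
  · have hN0 : N ≠ ⊥ := fun h => by
      rw [h, Subgroup.card_bot] at hN
      omega
    rw [eq_prod_bot h, weight_prod_bot hc hp hp3 hn hG hN hu hu1,
      if_neg (graph_one_ne_prod_bot (top_ne_bot_of_ne_bot hN0) _)]
  · rw [weight_eq_of_rightKer_eq_bot_of_ne hc hp hp3 hG hu hu1 hL h]
    exact if_congr eq_comm rfl rfl

end

noncomputable section

open scoped Classical

/-! ### The idempotent `Inf ∘ Def` -/

section Idempotent

variable {G : Type u} [CommGroup G]

/-- The relation `{(x, y) | x N = y N}`. -/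
def cosetRel (N : Subgroup G) : Subgroup (G × G) where
  carrier := {a | a.1 * a.2⁻¹ ∈ N}
  one_mem' := by simp [one_mem]
  mul_mem' := by
    intro a b ha hb
    have := N.mul_mem ha hb
    rwa [mul_mul_mul_comm, ← mul_inv] at this
  inv_mem' := by
    intro a ha
    have := N.inv_mem ha
    rwa [mul_inv] at this

theorem mem_cosetRel {N : Subgroup G} {a : G × G} : a ∈ cosetRel N ↔ a.1 * a.2⁻¹ ∈ N := Iff.rfl

theorem card_cosetRel (N : Subgroup G) : Nat.card (cosetRel N) = Nat.card N * Nat.card G := by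
  rw [← Nat.card_prod]
  refine Nat.card_congr
    { toFun := fun a => (⟨a.1.1 * a.1.2⁻¹, a.2⟩, a.1.2)
      invFun := fun b => ⟨(b.1.1 * b.2, b.2), mem_cosetRel.2 (by simp)⟩
      left_inv := fun a => by simp
      right_inv := fun b => by simp }

theorem rightKer_cosetRel (N : Subgroup G) : rightKer (cosetRel N) = N := by
  ext x
  simp [mem_rightKer, mem_cosetRel]

theorem relComp_cosetRel {N : Subgroup G} {L : Subgroup (G × G)} (h : N ≤ leftKer L) :
    relComp (cosetRel N) L = L := by
  ext a
  rw [mem_relComp]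
  constructor
  · rintro ⟨y, h1, h2⟩
    have h3 := mul_mem (mem_leftKer.1 (h (mem_cosetRel.1 h1))) h2
    simpa using h3
  · exact fun ha => ⟨a.1, mem_cosetRel.2 (by simp [one_mem]), ha⟩

theorem le_leftKer_relComp_cosetRel (N : Subgroup G) (L : Subgroup (G × G)) :
    N ≤ leftKer (relComp (cosetRel N) L) :=
  fun x hx => ⟨1, mem_cosetRel.2 (by simpa using hx), one_mem L⟩

variable [Finite G]

/-- Multiplication identifies the tensor product with `G / N`, which is transitive under `G × G`;
the base point is fixed by `(x, y)` exactly when `x N = y N`. -/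
theorem Inf_comp_Def (N : Subgroup G) : B.comp (B.Inf N) (B.Def N) = B.basis (cosetRel N) := by
  rw [B.Inf, B.Def, B.comp_mk, B.basis]
  set X := FinBiset.tensor (FinBiset.inflation N) (FinBiset.deflation N) with hX
  let pt : G ⧸ N → G ⧸ N → X := fun q r =>
    Quotient.mk (FinBiset.tensorSetoid (FinBiset.inflation N) (FinBiset.deflation N)) (q, r)
  have smul_pt : ∀ (a : G × G) (q r : G ⧸ N),
      a • pt q r = pt ((a.1 : G ⧸ N) * q) (r * ((a.2⁻¹ : G) : G ⧸ N)) := fun _ _ _ => rfl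
  have pt_eq : ∀ q r q' r' : G ⧸ N, pt q r = pt q' r' ↔ q * r = q' * r' := by
    intro q r q' r'
    refine Quotient.eq.trans ?_
    constructor
    · rintro ⟨h, hh⟩
      obtain ⟨h1, h2⟩ := Prod.ext_iff.1 hh
      have h1 : q' = q * h⁻¹ := h1
      have h2 : r' = h * r := h2
      rw [h1, h2]
      group
    · intro h
      refine ⟨q'⁻¹ * q, Prod.ext ?_ ?_⟩
      · change q' = q * (q'⁻¹ * q)⁻¹
        rw [mul_inv_rev, inv_inv, mul_inv_cancel_left]
      · change r' = (q'⁻¹ * q) * r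
        rw [mul_assoc, h, inv_mul_cancel_left]
  have hs : X.stab (pt 1 1) = cosetRel N := by
    ext a
    refine FinBiset.mem_stab_iff_smul.trans ?_
    rw [smul_pt, pt_eq, mem_cosetRel, mul_one, one_mul, one_mul, ← QuotientGroup.mk_mul,
      QuotientGroup.eq_one_iff]
  rw [← hs]
  refine (B.mk_eq (FinBiset.isomorphic_ofSubgroup X (pt 1 1) ?_)).symm
  rintro ⟨q, r⟩
  obtain ⟨g, hg⟩ := QuotientGroup.mk_surjective (s := N) (show G ⧸ N from q)
  obtain ⟨h, hh⟩ := QuotientGroup.mk_surjective (s := N) (show G ⧸ N from r)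
  refine ⟨(g, h⁻¹), ?_⟩
  rw [smul_pt, inv_inv, mul_one, one_mul]
  change pt q r = pt _ _
  rw [hg, hh]

/-- Composing with `cosetRel N` leaves a relation with left kernel above `N` unchanged. The overlap
`|N|` cancels the weight `1 / |N|` of `cosetRel N`. -/
theorem cosetRel_mul {N : Subgroup G} {a : B G G} (h : ∀ L, weight L a ≠ 0 → N ≤ leftKer L) :
    B.basis (cosetRel N) * a = a := by
  refine weight_ext fun P => ?_
  rw [weight_mul, Finset.sum_eq_single (cosetRel N)]
  · have hG : (Nat.card G : ℚ) ≠ 0 := Nat.cast_ne_zero.2 Nat.card_pos.ne'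
    have hN : (Nat.card N : ℚ) ≠ 0 := Nat.cast_ne_zero.2 Nat.card_pos.ne'
    have e : ∀ M, (if relComp (cosetRel N) M = P then
        (overlap (cosetRel N) M : ℚ) * weight (cosetRel N) (B.basis (cosetRel N)) * weight M a
          else 0) = if M = P then weight M a else 0 := by
      intro M
      by_cases hM : weight M a = 0
      · simp [hM]
      · have hle := h M hM
        rw [relComp_cosetRel hle, overlap, rightKer_cosetRel, inf_eq_left.2 hle, weight_basis,
          if_pos rfl, card_cosetRel]
        refine if_congr Iff.rfl ?_ rfl
        push_cast
        field_simp
    rw [Finset.sum_congr rfl fun M _ => e M]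
    simp
  · intro L _ hL
    refine Finset.sum_eq_zero fun M _ => ?_
    rw [weight_basis, if_neg (Ne.symm hL)]
    simp
  · simp

theorem dual_basis_cosetRel (N : Subgroup G) :
    B.dual (B.basis (cosetRel N)) = B.basis (cosetRel N) := by
  rw [← Inf_comp_Def, B.dual_comp, B.dual_Inf, B.dual_Def]

theorem mul_cosetRel {N : Subgroup G} {a : B G G} (h : ∀ L, weight L a ≠ 0 → N ≤ rightKer L) :
    a * B.basis (cosetRel N) = a := by
  rw [← B.dual_dual (a * _), B.dual_mul, dual_basis_cosetRel, cosetRel_mul, B.dual_dual]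
  intro L hL
  rw [weight_dual] at hL
  exact h _ hL

/-- Every relation occurring in such a product contains `N × 1`, whereas a graph has trivial left
kernel. -/
theorem weight_cosetRel_mul_graph {N : Subgroup G} (hN : N ≠ ⊥) (a : B G G) (φ : MulAut G) :
    weight (graph φ) (B.basis (cosetRel N) * a) = 0 := by
  rw [weight_mul, Finset.sum_eq_single (cosetRel N)]
  · refine Finset.sum_eq_zero fun M _ => if_neg fun h => hN ?_
    have hle := le_leftKer_relComp_cosetRel N M
    rw [h] at hle
    refine (Subgroup.eq_bot_iff_forall _).2 fun x hx => ?_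
    have := mem_graph.1 (mem_leftKer.1 (hle hx))
    simpa using this
  · intro L _ hL
    refine Finset.sum_eq_zero fun M _ => ?_
    rw [weight_basis, if_neg (Ne.symm hL)]
    simp
  · simp

theorem cosetRel_mul_inflate (N : Subgroup G) (b : B (G ⧸ N) (G ⧸ N)) :
    B.basis (cosetRel N) * B.inflate N b = B.inflate N b := by
  have h : B.comp (B.Def N) (B.comp (B.comp (B.Inf N) b) (B.Def N)) = B.comp b (B.Def N) := by
    rw [← B.comp_assoc, ← B.comp_assoc, B.Def_comp_Inf]
    exact congrArg (fun t => B.comp t (B.Def N)) (one_mul b)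
  rw [← Inf_comp_Def, B.mul_def, B.inflate_apply, B.comp_assoc, h, ← B.comp_assoc]

/-- Because `Def ∘ Inf` is the identity, `c ↦ Def ∘ c ∘ Inf` is a left inverse. -/
theorem inflate_injective (N : Subgroup G) : Function.Injective (B.inflate N) := by
  refine Function.LeftInverse.injective
    (g := fun c => B.comp (B.comp (B.Def N) c) (B.Inf N)) fun b => ?_
  change B.comp (B.comp (B.Def N) (B.comp (B.comp (B.Inf N) b) (B.Def N))) (B.Inf N) = b
  rw [B.comp_assoc, B.comp_assoc _ (B.Def N), B.Def_comp_Inf]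
  have h1 : B.comp (B.comp (B.Inf N) b) 1 = B.comp (B.Inf N) b := B.comp_id _
  rw [h1, ← B.comp_assoc, B.Def_comp_Inf]
  exact B.id_comp b

theorem inflate_comp (N : Subgroup G) (a : B G G) :
    B.inflate N (B.comp (B.comp (B.Def N) a) (B.Inf N)) =
      B.basis (cosetRel N) * a * B.basis (cosetRel N) := by
  rw [← Inf_comp_Def, B.inflate_apply, B.mul_def, B.mul_def]
  simp only [B.comp_assoc]

/-- An orthogonal unit that differs from `1` by relations containing `N × N` lies in the image of
`dBInf`. -/
theorem mem_range_dBInfOrthogonal {N : Subgroup G} (u : B.orthogonalUnits G)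
    (hl : ∀ L, weight L (((u : (B G G)ˣ) : B G G) - 1) ≠ 0 → N ≤ leftKer L)
    (hr : ∀ L, weight L (((u : (B G G)ˣ) : B G G) - 1) ≠ 0 → N ≤ rightKer L) :
    u ∈ (B.dBInfOrthogonal N).range := by
  obtain ⟨u, hu⟩ := u
  obtain ⟨hu1, hu2⟩ := B.mem_orthogonalUnits.1 hu
  set a : B G G := (u : B G G) - 1 with ha
  have hua : (u : B G G) = 1 + a := by rw [ha]; abel
  -- Inflating this deflation of `u - 1` multiplies `u - 1` on both sides by `Inf ∘ Def`, which
  -- changes nothing by the hypotheses on kernels. Hence `1 + b` is the required preimage.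
  let b := B.comp (B.comp (B.Def N) a) (B.Inf N)
  have hb : B.inflate N b = a := by
    rw [inflate_comp, cosetRel_mul hl, mul_cosetRel hr]
  have h1 : (1 + b) * B.dual (1 + b) = 1 := by
    have e : (1 + b) * B.dual (1 + b) = 1 + (b + B.dual b + b * B.dual b) := by
      rw [map_add, B.dual_one]
      noncomm_ring
    -- Inflation is injective, multiplicative and compatible with duality, so the relation can be
    -- checked in `B(G, G)`, where it is `u u° = 1`.
    have hz : b + B.dual b + b * B.dual b = 0 := by
      refine inflate_injective N ?_
      rw [map_add, map_add, B.inflate_mul, ← B.dual_inflate, hb, map_zero]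
      rw [hua, map_add, B.dual_one] at hu1
      have : (1 + a) * (1 + B.dual a) = 1 + (a + B.dual a + a * B.dual a) := by noncomm_ring
      rw [this] at hu1
      simpa using hu1
    rw [e, hz, add_zero]
  have h2 : B.dual (1 + b) * (1 + b) = 1 := by
    have e : B.dual (1 + b) * (1 + b) = 1 + (b + B.dual b + B.dual b * b) := by
      rw [map_add, B.dual_one]
      noncomm_ring
    have hz : b + B.dual b + B.dual b * b = 0 := by
      refine inflate_injective N ?_
      rw [map_add, map_add, B.inflate_mul, ← B.dual_inflate, hb, map_zero]
      rw [hua, map_add, B.dual_one] at hu2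
      have : (1 + B.dual a) * (1 + a) = 1 + (a + B.dual a + B.dual a * a) := by noncomm_ring
      rw [this] at hu2
      simpa using hu2
    rw [e, hz, add_zero]
  refine ⟨⟨⟨1 + b, B.dual (1 + b), h1, h2⟩, B.mem_orthogonalUnits.2 ⟨h1, h2⟩⟩, ?_⟩
  refine Subtype.ext (Units.ext ?_)
  change 1 + B.inflate N (1 + b - 1) = (u : B G G)
  rw [add_sub_cancel_left, hb, hua]

theorem weight_graph_of_mem_range_dBInfOrthogonal {N : Subgroup G} (hN : N ≠ ⊥)
    {u : B.orthogonalUnits G} (hu : u ∈ (B.dBInfOrthogonal N).range) (φ : MulAut G) :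
    weight (graph φ) ((u : (B G G)ˣ) : B G G) = if φ = 1 then 1 else 0 := by
  obtain ⟨v, rfl⟩ := hu
  change weight (graph φ) (1 + B.inflate N (((v : (B (G ⧸ N) (G ⧸ N))ˣ) : B (G ⧸ N) (G ⧸ N)) - 1))
    = _
  rw [← cosetRel_mul_inflate, map_add, weight_cosetRel_mul_graph hN, weight_one, add_zero]
  exact if_congr (graph_injective.eq_iff.trans eq_comm) rfl rfl

end Idempotent

/-! ### The maps `ρ` and `η` -/

section RhoEta

variable {G : Type u} [CommGroup G]

theorem hasGraphStabilizer_iff {X : FinBiset G G} {x : X} {φ : MulAut G} :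
    HasGraphStabilizer X x φ ↔ X.stab x = graph φ :=
  (SetLike.ext_iff (p := X.stab x) (q := graph φ)).symm

/-- Inner automorphisms of an abelian group are trivial. -/
theorem out_mk_eq_iff {φ ψ : MulAut G} : (φ : Out G) = (ψ : Out G) ↔ φ = ψ := by
  rw [QuotientGroup.eq]
  constructor
  · rintro ⟨c, hc⟩
    have : (MulAut.conj c : MulAut G) = 1 := by
      ext x
      simp [MulAut.conj_apply]
    rw [this] at hc
    exact (inv_mul_eq_one.1 hc.symm)
  · rintro rfl
    rw [inv_mul_cancel]
    exact one_mem _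

theorem outUnits_mem_signedOut (ω : Out G) : outUnits G ω ∈ signedOut G :=
  Subgroup.subset_closure (Set.mem_insert_of_mem _ ⟨ω, rfl⟩)

theorem neg_outUnits_mem_signedOut (ω : Out G) : -outUnits G ω ∈ signedOut G := by
  rw [← neg_one_mul]
  exact mul_mem (Subgroup.subset_closure (Set.mem_insert _ _)) (outUnits_mem_signedOut ω)

theorem eq_or_eq_neg_outUnits {s : (ZOut G)ˣ} (hs : s ∈ signedOut G) :
    ∃ φ : MulAut G, s = outUnits G (φ : Out G) ∨ s = -outUnits G (φ : Out G) := by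
  suffices h : ∃ ω : Out G, s = outUnits G ω ∨ s = -outUnits G ω by
    obtain ⟨ω, hω⟩ := h
    obtain ⟨φ, rfl⟩ := QuotientGroup.mk_surjective ω
    exact ⟨φ, hω⟩
  induction hs using Subgroup.closure_induction with
  | mem x hx =>
    rcases hx with rfl | ⟨ω, rfl⟩
    · exact ⟨1, Or.inr (by rw [map_one])⟩
    · exact ⟨ω, Or.inl rfl⟩
  | one => exact ⟨1, Or.inl (map_one _).symm⟩
  | mul x y _ _ hx hy =>
    obtain ⟨ω, rfl | rfl⟩ := hx <;> obtain ⟨τ, rfl | rfl⟩ := hy <;> refine ⟨ω * τ, ?_⟩ <;>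
      simp [map_mul]
  | inv x _ hx =>
    obtain ⟨ω, rfl | rfl⟩ := hx <;> refine ⟨ω⁻¹, ?_⟩ <;> simp

variable [Finite G]

theorem orbitCount_ofSubgroup (L : Subgroup (G × G)) (φ : MulAut G) :
    orbitCount (FinBiset.ofSubgroup L) (φ : Out G) = if L = graph φ then 1 else 0 := by
  have stab_iff : ∀ (x : FinBiset.ofSubgroup L) (ψ : MulAut G),
      HasGraphStabilizer (FinBiset.ofSubgroup L) x ψ ↔ L = graph ψ := fun x ψ => by
    rw [hasGraphStabilizer_iff, FinBiset.ofSubgroup_stab]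
  let o : FinBiset.ofSubgroup L := (QuotientGroup.mk 1 : (G × G) ⧸ L)
  rw [orbitCount]
  split_ifs with h
  · rw [Set.ncard_eq_one]
    refine ⟨Quotient.mk (orbitSetoid _) o, ?_⟩
    ext q
    rw [Set.mem_singleton_iff]
    constructor
    · intro _
      obtain ⟨x, rfl⟩ := Quotient.exists_rep q
      obtain ⟨a, rfl⟩ := QuotientGroup.mk_surjective (s := L) x
      refine Quotient.sound (s := orbitSetoid _) ?_
      refine Setoid.symm' (orbitSetoid (FinBiset.ofSubgroup L)) ⟨a.1, a.2⁻¹, ?_⟩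
      have := FinBiset.ofSubgroup_prod_smul L a 1
      rw [mul_one] at this
      exact this.symm
    · rintro rfl
      exact ⟨o, φ, rfl, rfl, (stab_iff o φ).2 h⟩
  · rw [Set.ncard_eq_zero (finite_orbits _ _)]
    ext q
    refine iff_of_false ?_ fun h => h
    rintro ⟨x, ψ, -, hψ, hs⟩
    rw [out_mk_eq_iff.1 hψ] at hs
    exact h ((stab_iff x φ).1 hs)

/-- Both sides are additive, so transitive bisets suffice. An orbit with stabilizer `Δ_φ(G)` has
`|G|` points, which the division by `|G|` in `weight` turns into `1`. -/
theorem coeff_rho (a : B G G) (φ : MulAut G) :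
    ((rho G a).coeff (φ : Out G) : ℚ) = weight (graph φ) a := by
  let f : B G G →+ ℚ :=
    { toFun := fun a => ((rho G a).coeff (φ : Out G) : ℚ)
      map_zero' := by simp
      map_add' := fun a b => by simp }
  have : f = weight (graph φ) := B.hom_ext_basis fun L => by
    change ((rho G (B.basis L)).coeff (φ : Out G) : ℚ) = _
    have := Fintype.ofFinite (Out G)
    rw [B.basis, rho_mk, finsum_eq_sum_of_fintype, MonoidAlgebra.coeff_sum, Finsupp.finsetSum_apply,
      Finset.sum_eq_single (φ : Out G)]
    · rw [MonoidAlgebra.coeff_single, Finsupp.single_apply, if_pos rfl, orbitCount_ofSubgroup]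
      change _ = weight (graph φ) (B.basis L)
      rw [weight_basis]
      split_ifs with h
      · rw [card_graph, div_self (Nat.cast_ne_zero.2 Nat.card_pos.ne')]
        simp
      · simp
    · intro ω _ hω
      rw [MonoidAlgebra.coeff_single, Finsupp.single_apply, if_neg hω]
    · simp
  exact DFunLike.congr_fun this a

theorem rho_eq_one_iff (a : B G G) :
    rho G a = 1 ↔ ∀ φ : MulAut G, weight (graph φ) a = if φ = 1 then 1 else 0 := by
  have one_coeff : ∀ φ : MulAut G,
      (((1 : ZOut G).coeff (φ : Out G) : ℤ) : ℚ) = if φ = 1 then 1 else 0 := by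
    intro φ
    rw [MonoidAlgebra.one_def, MonoidAlgebra.coeff_single, Finsupp.single_apply]
    have : ((1 : Out G) = (φ : Out G)) ↔ φ = 1 := by
      rw [eq_comm, ← QuotientGroup.mk_one, out_mk_eq_iff]
    simp only [this]
    split_ifs <;> simp
  constructor
  · intro h φ
    rw [← coeff_rho, h, one_coeff]
  · intro h
    ext ω
    obtain ⟨φ, rfl⟩ := QuotientGroup.mk_surjective ω
    have h1 := coeff_rho a φ
    rw [h φ, ← one_coeff φ] at h1
    exact_mod_cast h1

/-- The first projection is injective and the second surjective, so `|P| = |G|` and both are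
bijective; the automorphism is the first after the inverse of the second. -/
theorem exists_eq_graph_of_isSlice_top {P : Subgroup (G × G)} (hP : IsSlice ⊤ P) :
    ∃ φ : MulAut G, P = graph φ := by
  let f : P →* G := (MonoidHom.fst G G).comp P.subtype
  let g : P →* G := (MonoidHom.snd G G).comp P.subtype
  have hf : Function.Injective f := by
    rintro ⟨⟨x, y⟩, ha⟩ ⟨⟨x', y'⟩, hb⟩ (rfl : x = x')
    have := mul_mem ha (inv_mem hb)
    have := rightKer_eq_bot_iff.1 hP.1 (y * y'⁻¹) (by simpa using this)
    rw [mul_inv_eq_one] at this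
    subst this
    rfl
  have hg : Function.Surjective g := fun y => by
    obtain ⟨x, hx⟩ := hP.2 y (Subgroup.mem_top y)
    exact ⟨⟨(x, y), hx⟩, rfl⟩
  have hcard : Nat.card P = Nat.card G :=
    le_antisymm (Nat.card_le_card_of_injective f hf) (Nat.card_le_card_of_surjective g hg)
  have hf' := (Nat.bijective_iff_injective_and_card f).2 ⟨hf, hcard⟩
  have hg' := (Nat.bijective_iff_surjective_and_card g).2 ⟨hg, hcard⟩
  refine ⟨(MulEquiv.ofBijective g hg').symm.trans (MulEquiv.ofBijective f hf'), ?_⟩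
  ext a
  have hgraph : a ∈ graph ((MulEquiv.ofBijective g hg').symm.trans (MulEquiv.ofBijective f hf') :
      MulAut G) ↔ a.1 = f ((MulEquiv.ofBijective g hg').symm a.2) := mem_graph
  rw [hgraph]
  constructor
  · intro ha
    have : (MulEquiv.ofBijective g hg').symm a.2 = ⟨a, ha⟩ :=
      (MulEquiv.symm_apply_eq _).2 rfl
    rw [this]
    rfl
  · intro h
    have h2 : g ((MulEquiv.ofBijective g hg').symm a.2) = a.2 :=
      (MulEquiv.ofBijective g hg').apply_symm_apply a.2
    have : a = ((MulEquiv.ofBijective g hg').symm a.2 : P) := Prod.ext h h2.symm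
    rw [this]
    exact SetLike.coe_mem _

/-- An orthogonal element involves exactly one automorphism, with coefficient `1` or `-1`. -/
theorem exists_weight_graph (hc : ∀ A B : Subgroup G, A ≤ B ∨ B ≤ A)
    (hG : (⊤ : Subgroup G) ≠ ⊥) {u : B G G} (hu : B.dual u * u = 1) :
    ∃ φ : MulAut G, weight (graph φ) u = 1 ∨ weight (graph φ) u = -1 := by
  have h := sum_sliceWeight_sq hc hu hG
  obtain ⟨P, -, hP⟩ := Finset.exists_ne_zero_of_sum_ne_zero (h.trans_ne one_ne_zero)
  have hs : IsSlice ⊤ P := by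
    by_contra hs
    exact hP (if_neg hs)
  have hne : weight P u ≠ 0 := fun h0 => hP (by rw [sliceWeight_top, h0]; simp)
  have hle := sliceWeight_sq_le_one hc hu hG hs
  rw [sliceWeight_top] at hle
  obtain ⟨φ, rfl⟩ := exists_eq_graph_of_isSlice_top hs
  refine ⟨φ, ?_⟩
  -- As a coefficient of `ρ(u)` the weight is an integer; being nonzero with square at most `1`, it
  -- is `±1`.
  rw [← coeff_rho] at hne hle ⊢
  generalize (rho G u).coeff (φ : Out G) = t at *
  have h1 : t ^ 2 ≤ 1 := by exact_mod_cast hle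
  have h0 : t ≠ 0 := by exact_mod_cast hne
  have h2 := abs_le.1 ((sq_le_one_iff_abs_le_one t).1 h1)
  have : t = 1 ∨ t = -1 := by omega
  exact this.imp (fun h => by simp [h]) fun h => by simp [h]

/-- An automorphism of a cyclic group is a power map, so acting on both coordinates it preserves
every subgroup of `G × G`. Moving it from one coordinate to the other therefore gives the same
relation. -/
theorem graph_mul_comm [IsCyclic G] (φ : MulAut G) (a : B G G) :
    B.mk (FinBiset.ofSubgroup (graph φ)) * a = a * B.mk (FinBiset.ofSubgroup (graph φ)) := by
  have stable : ∀ (ψ : MulAut G) (P : Subgroup (G × G)) (x y : G), (x, y) ∈ P → (ψ x, ψ y) ∈ P := by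
    intro ψ P x y h
    obtain ⟨m, hm⟩ := MonoidHom.map_cyclic ψ.toMonoidHom
    have hx : ψ x = x ^ m := hm x
    have hy : ψ y = y ^ m := hm y
    rw [hx, hy]
    exact zpow_mem h m
  refine weight_ext fun P => ?_
  rw [weight_graph_mul, weight_mul_graph]
  congr 2
  ext a
  rw [relComp_graph_left, relComp_graph_right, inv_inv]
  constructor
  · intro h
    simpa using stable φ⁻¹ P _ _ h
  · intro h
    simpa using stable φ P _ _ h

theorem coe_etaOrthogonal (s : signedOut G) :
    ((etaOrthogonal G s : (B G G)ˣ) : B G G) = eta G ((s : (ZOut G)ˣ) : ZOut G) := rfl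

theorem eta_outUnits (φ : MulAut G) :
    eta G ((outUnits G (φ : Out G) : (ZOut G)ˣ) : ZOut G) =
      B.mk (FinBiset.ofSubgroup (graph φ)) := eta_of φ

theorem etaOrthogonal_mul_comm [IsCyclic G] (s : signedOut G) (u : B.orthogonalUnits G) :
    etaOrthogonal G s * u = u * etaOrthogonal G s := by
  refine Subtype.ext (Units.ext ?_)
  change eta G ((s : (ZOut G)ˣ) : ZOut G) * ((u : (B G G)ˣ) : B G G) =
    ((u : (B G G)ˣ) : B G G) * eta G ((s : (ZOut G)ˣ) : ZOut G)
  obtain ⟨φ, h | h⟩ := eq_or_eq_neg_outUnits s.2 <;> rw [h]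
  · rw [eta_outUnits, graph_mul_comm]
  · rw [Units.val_neg, map_neg, eta_outUnits, neg_mul, mul_neg, graph_mul_comm]

end RhoEta

/-! ### Cyclic `p`-groups -/

section CyclicPGroup

variable {G : Type u} [CommGroup G] [Finite G] [IsCyclic G]

/-- In a cyclic group `g ^ |B| = 1` has at most `|B|` solutions, so `B` is the whole solution set
and contains `A`. -/
theorem le_of_card_dvd_card {A B : Subgroup G} (h : Nat.card A ∣ Nat.card B) : A ≤ B := by
  have := Fintype.ofFinite G
  have hB : (B : Set G).toFinset ⊆ Finset.univ.filter fun g : G => g ^ Nat.card B = 1 := by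
    intro g hg
    rw [Set.mem_toFinset] at hg
    exact Finset.mem_filter.2 ⟨Finset.mem_univ g,
      congrArg Subtype.val (pow_card_eq_one' (x := (⟨g, hg⟩ : B)))⟩
  have hle := IsCyclic.card_pow_eq_one_le (α := G) (n := Nat.card B) Nat.card_pos
  have hcard : (B : Set G).toFinset.card = Nat.card B := by
    rw [Set.toFinset_card, Nat.card_eq_fintype_card]
    rfl
  have e := Finset.eq_of_subset_of_card_le hB (by rw [hcard]; exact hle)
  intro g hg
  have hgA : g ^ Nat.card A = 1 := congrArg Subtype.val (pow_card_eq_one' (x := (⟨g, hg⟩ : A)))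
  have : g ∈ Finset.univ.filter fun g : G => g ^ Nat.card B = 1 := by
    obtain ⟨k, hk⟩ := h
    rw [Finset.mem_filter, hk, pow_mul, hgA, one_pow]
    exact ⟨Finset.mem_univ g, rfl⟩
  rw [← e, Set.mem_toFinset] at this
  exact this

theorem le_total_of_card_eq_prime_pow {p n : ℕ} (hp : p.Prime) (hG : Nat.card G = p ^ n)
    (A B : Subgroup G) : A ≤ B ∨ B ≤ A := by
  obtain ⟨i, -, hi⟩ := (Nat.dvd_prime_pow hp).1 (hG ▸ Subgroup.card_subgroup_dvd_card A)
  obtain ⟨j, -, hj⟩ := (Nat.dvd_prime_pow hp).1 (hG ▸ Subgroup.card_subgroup_dvd_card B)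
  rcases le_total i j with h | h
  · exact Or.inl (le_of_card_dvd_card (by rw [hi, hj]; exact pow_dvd_pow p h))
  · exact Or.inr (le_of_card_dvd_card (by rw [hi, hj]; exact pow_dvd_pow p h))

/-- The result on trivial right kernels, applied to `u` and to `u°`, shows that `u - 1` involves
only relations with both kernels nontrivial, hence above `N`. -/
theorem mem_range_dBInfOrthogonal_of_weight_graph_one {p n : ℕ} (hp : p.Prime) (hp_odd : p ≠ 2)
    (hn : 1 < n) (hG : Nat.card G = p ^ n) {N : Subgroup G} (hN : Nat.card N = p)
    (u : B.orthogonalUnits G) (hu1 : weight (graph 1) ((u : (B G G)ˣ) : B G G) = 1) :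
    u ∈ (B.dBInfOrthogonal N).range := by
  have hc := le_total_of_card_eq_prime_pow hp hG
  have hp3 : 3 ≤ p := by
    have := hp.two_le
    omega
  obtain ⟨h1, h2⟩ := B.mem_orthogonalUnits.1 u.2
  refine mem_range_dBInfOrthogonal u (fun L hL => ?_) fun L hL => ?_
  · refine le_of_ne_bot hc hp hN fun h => hL ?_
    have hd := weight_eq_of_rightKer_eq_bot hc hp hp3 hn hG hN
      (u := B.dual ((u : (B G G)ˣ) : B G G)) (by rw [B.dual_dual]; exact h1)
      (by
        rw [weight_dual, ← hu1]
        congr 2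
        ext a
        rw [mem_converse, mem_graph_one, mem_graph_one]
        exact eq_comm) (L := converse L) (by rw [rightKer_converse, h])
    rw [← B.dual_one, weight_dual, weight_dual, converse_converse] at hd
    rw [map_sub, hd, sub_self]
  · refine le_of_ne_bot hc hp hN fun h => hL ?_
    rw [map_sub, weight_eq_of_rightKer_eq_bot hc hp hp3 hn hG hN h2 hu1 h, sub_self]

end CyclicPGroup

end

end DoubleBurnside

/-! ### The direct product decomposition -/

theorem proposition5 {G : Type u} [CommGroup G] [Finite G] [IsCyclic G] {p n : ℕ}
    (hp : p.Prime) (hp_odd : p ≠ 2) (hn : 1 < n) (hG : Nat.card G = p ^ n)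
    (N : Subgroup G) (hN : Nat.card N = p) :
    DoubleBurnside.IsInternalDirectProduct (Γ := DoubleBurnside.B.orthogonalUnits G)
        (DoubleBurnside.etaOrthogonal G).range (DoubleBurnside.B.dBInfOrthogonal N).range ∧
      ∀ u : DoubleBurnside.B.orthogonalUnits G,
        DoubleBurnside.rho G ((u : (DoubleBurnside.B G G)ˣ) : DoubleBurnside.B G G) = 1 ↔
          u ∈ (DoubleBurnside.B.dBInfOrthogonal N).range := by
  open DoubleBurnside in
  have hN0 : N ≠ ⊥ := fun h => by
    rw [h, Subgroup.card_bot] at hN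
    exact hp.ne_one hN.symm
  have htop := top_ne_bot_of_ne_bot hN0
  have hc := le_total_of_card_eq_prime_pow hp hG
  have key := mem_range_dBInfOrthogonal_of_weight_graph_one hp hp_odd hn hG hN
  -- Multiplying by the inverse of the one signed automorphism occurring in `u` gives the diagonal
  -- coefficient `1`.
  have decomp : ∀ u : B.orthogonalUnits G, ∃ s : signedOut G,
      etaOrthogonal G s * u ∈ (B.dBInfOrthogonal N).range := by
    intro u
    obtain ⟨φ, hφ⟩ := exists_weight_graph hc htop (B.mem_orthogonalUnits.1 u.2).2
    have hw : weight (graph 1)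
        (B.mk (FinBiset.ofSubgroup (graph φ⁻¹)) * ((u : (B G G)ˣ) : B G G)) =
          weight (graph φ) ((u : (B G G)ˣ) : B G G) := by
      rw [weight_graph_mul, inv_inv, relComp_graph_one_right]
    rcases hφ with h | h
    · refine ⟨⟨_, outUnits_mem_signedOut ((φ⁻¹ : MulAut G) : Out G)⟩, key _ ?_⟩
      rw [Subgroup.coe_mul, Units.val_mul, coe_etaOrthogonal, eta_outUnits, hw, h]
    · refine ⟨⟨_, neg_outUnits_mem_signedOut ((φ⁻¹ : MulAut G) : Out G)⟩, key _ ?_⟩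
      rw [Subgroup.coe_mul, Units.val_mul, coe_etaOrthogonal, Units.val_neg, map_neg, eta_outUnits,
        neg_mul, map_neg, hw, h, neg_neg]
  refine ⟨⟨⟨?_⟩, ⟨?_⟩, ?_, ?_⟩, fun u => ?_⟩
  · rintro _ ⟨s, rfl⟩ u
    rw [← etaOrthogonal_mul_comm, mul_inv_cancel_right]
    exact ⟨s, rfl⟩
  · intro t ht u
    obtain ⟨s, hs⟩ := decomp u
    have e' : (etaOrthogonal G s * u) * t * (etaOrthogonal G s * u)⁻¹ =
        etaOrthogonal G s * (u * t * u⁻¹) * (etaOrthogonal G s)⁻¹ := by group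
    -- Since `im(η)` is central, conjugation by `u` agrees with conjugation by an element of the
    -- image of `dBInf`.
    have e : u * t * u⁻¹ = (etaOrthogonal G s * u) * t * (etaOrthogonal G s * u)⁻¹ := by
      rw [e', etaOrthogonal_mul_comm, mul_inv_cancel_right]
    rw [e]
    exact mul_mem (mul_mem hs ht) (inv_mem hs)
  · refine (Subgroup.eq_bot_iff_forall _).2 ?_
    rintro _ ⟨⟨s, rfl⟩, ht⟩
    obtain ⟨φ, h⟩ := eq_or_eq_neg_outUnits s.2
    have hw := weight_graph_of_mem_range_dBInfOrthogonal hN0 ht φ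
    rw [coe_etaOrthogonal] at hw
    rcases h with h | h
    · rw [h, eta_outUnits, weight_mk_graph, if_pos rfl] at hw
      have hφ : φ = 1 := by
        by_contra hφ
        rw [if_neg hφ] at hw
        exact one_ne_zero hw
      have hs : s = 1 := Subtype.ext (by rw [h, hφ]; exact map_one (outUnits G))
      rw [hs, map_one]
    · rw [h, Units.val_neg, map_neg, eta_outUnits, map_neg, weight_mk_graph, if_pos rfl] at hw
      -- A sign `-1` is impossible, as elements of the image of `dBInf` have automorphism
      -- coefficients `0` or `1`.
      split_ifs at hw <;> norm_num at hw
  · refine eq_top_iff.2 fun u _ => ?_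
    obtain ⟨s, hs⟩ := decomp u
    have e : u = (etaOrthogonal G s)⁻¹ * (etaOrthogonal G s * u) := by group
    rw [e]
    exact mul_mem (inv_mem (Subgroup.mem_sup_left ⟨s, rfl⟩)) (Subgroup.mem_sup_right hs)
  · rw [rho_eq_one_iff]
    -- The coefficient at the identity automorphism alone already forces membership.
    exact ⟨fun h => key u (by simpa using h 1),
      fun h => weight_graph_of_mem_range_dBInfOrthogonal hN0 h⟩
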